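/- Let $\mathcal L$ be a lattice without boundaries, i.e. a finite cell decomposition (vertices $V$, edges $E$, faces $F$) of a closed surface, not necessarily connected or orientable. Assume that $\mathcal L$ is 3-valent (at each vertex there are exactly three ends of edges) and that its faces are colored with three colors $A,B,C$ so that the two faces along any edge have different colors; an edge between faces of colors $B$ and $C$ is called a $BC$ edge, etc. The color code has one qubit on each vertex of $\mathcal L$, and its stabilizer group $CC(\mathcal L)$ is generated by $X(f)=\bigotimes_{v\in f}X(v)$ and $Z(f)=\bigotimes_{v\in f}Z(v)$ for all faces $f$. The toric code on a lattice $\mathcal M$ without boundaries has one qubit on each edge, and its stabilizer group $TC(\mathcal M)$ is generated by $X(v)=\prod_{e\ni v}X(e)$ for all vertices $v$ and $Z(f)=\prod_{e\subset f}Z(e)$ for all faces $f$, where incidences are counted with multiplicity (a loop $e$ at $v$ contributes $X(e)^2=1$). Let $\mathcal L_A$ be the lattice obtained from $\mathcal L$ by shrinking the faces of color $A$ to points: its vertices are the $A$ faces of $\mathcal L$, its edges are the $BC$ edges of $\mathcal L$ (each joining the $A$ faces at its two ends), and its faces are the $B$ and $C$ faces of $\mathcal L$. Let $\mathcal L_B$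 be obtained in the same way by shrinking the faces of color $B$; its edges are the $AC$ edges of $\mathcal L$. Then there is, for each face $f$ of color $C$, a Clifford unitary $U_f$ (a unitary that maps Pauli operators to Pauli operators by conjugation) from the Hilbert space of the qubits on the vertices of $f$ to the Hilbert space of the qubits on the edges of $f$, such that $$U=\bigotimes_{f\text{ of color }C}U_f,$$ which maps the Hilbert space of the qubits on all vertices of $\mathcal L$ to that of the qubits on the edges of $\mathcal L_A$ and of $\mathcal L_B$, is a Clifford unitary and satisfies $$U\,[CC(\mathcal L)]\,U^\dagger=TC(\mathcal L_A)\otimes TC(\mathcal L_B),$$ where $TC(\mathcal L_A)\otimes TC(\mathcal L_B)=\{S\otimes T: S\in TC(\mathcal L_A),\ T\in TC(\mathcal L_B)\}$. -/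

import Mathlib

noncomputable section

namespace ColorCode

/-! ### Lattices on closed surfaces -/

/-- `b` is obtained from `a` by finitely many moves, each of them `s` or `t`.  (For involutions
`s`, `t` this says that `a` and `b` lie in the same orbit of the group generated by `s`, `t`.) -/
def SameOrbit {Φ : Type*} (s t : Φ → Φ) (a b : Φ) : Prop :=
  Relation.ReflTransGen (fun x y => y = s x ∨ y = t x) a b

/-- A lattice without boundary: a cell decomposition, with vertices `V`, edges `E`, faces `F`, of a
surface without boundary (not necessarily connected or orientable; compact if `Φ` is finite).
It is described by its set `Φ` of flags.  A flag is a triangle of the barycentric subdivision: it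
sits at one end of one edge, on one of the two sides of this edge, and belongs to a vertex, an edge
and a face.  The involution `τ i` passes to the neighboring triangle across the side opposite to
the corner of dimension `i`, so it keeps the cells of the other two dimensions: `τ0` moves to the other end of the edge, `τ2` moves to the
other side of the edge, and `τ1` moves to the other edge in the same corner of the face.
Each edge thus carries exactly four flags.  Vertices, edges and faces are the orbits under the moves
that keep the corner of dimension `0`, `1`, `2` respectively.  Loops, multiple edges and faces with
few edges are allowed. -/
structure Lattice (V E F Φ : Type*) where
  τ0 : Φ → Φ
  τ1 : Φ → Φ
  τ2 : Φ → Φ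
  τ0_τ0 : ∀ φ, τ0 (τ0 φ) = φ
  τ1_τ1 : ∀ φ, τ1 (τ1 φ) = φ
  τ2_τ2 : ∀ φ, τ2 (τ2 φ) = φ
  τ0_ne : ∀ φ, τ0 φ ≠ φ
  τ1_ne : ∀ φ, τ1 φ ≠ φ
  τ2_ne : ∀ φ, τ2 φ ≠ φ
  τ0_τ2 : ∀ φ, τ0 (τ2 φ) = τ2 (τ0 φ)
  τ0_ne_τ2 : ∀ φ, τ0 φ ≠ τ2 φ
  vert : Φ → V
  edge : Φ → E
  face : Φ → F
  vert_surj : Function.Surjective vert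
  edge_surj : Function.Surjective edge
  face_surj : Function.Surjective face
  vert_eq_iff : ∀ φ ψ, vert φ = vert ψ ↔ SameOrbit τ1 τ2 φ ψ
  edge_eq_iff : ∀ φ ψ, edge φ = edge ψ ↔ SameOrbit τ0 τ2 φ ψ
  face_eq_iff : ∀ φ ψ, face φ = face ψ ↔ SameOrbit τ0 τ1 φ ψ

/-- The three colors. -/
inductive Color
  | A
  | B
  | C
  deriving DecidableEq

namespace Lattice

variable {V E F Φ : Type*}

/-- Every vertex belongs to exactly three edges, counted as ends of edges: there are two flags at
each end of an edge, one on each side. -/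
def ThreeValent (L : Lattice V E F Φ) : Prop :=
  ∀ v : V, Nat.card {φ : Φ // L.vert φ = v} = 2 * 3

/-- The two faces on the two sides of any edge have different colors. -/
def ProperColoring (L : Lattice V E F Φ) (col : F → Color) : Prop :=
  ∀ φ : Φ, col (L.face φ) ≠ col (L.face (L.τ2 φ))

/-- The edge `e` does not lie on a face of color `c`.  For a proper coloring, this says that the two
faces along `e` have the two colors different from `c`; e.g. for `c = A`, that `e` is a `BC` edge. -/
def Avoids (L : Lattice V E F Φ) (col : F → Color) (c : Color) (e : E) : Prop :=
  ∀ φ : Φ, L.edge φ = e → col (L.face φ) ≠ c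

/-- The vertices of the face `f`. -/
def faceVerts (L : Lattice V E F Φ) (f : F) : Set V :=
  {v | ∃ φ, L.vert φ = v ∧ L.face φ = f}

/-- The edges of the face `f`. -/
def faceEdges (L : Lattice V E F Φ) (f : F) : Set E :=
  {e | ∃ φ, L.edge φ = e ∧ L.face φ = f}

/-- The coboundary of the vertex `v` modulo 2: the edges with exactly one end at `v`. -/
def coboundary (L : Lattice V E F Φ) (v : V) : Set E :=
  {e | ∃ φ, L.edge φ = e ∧ L.vert φ = v ∧ L.vert (L.τ0 φ) ≠ v}

/-- The boundary of the face `f` modulo 2: the edges with exactly one side on `f`. -/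
def boundary (L : Lattice V E F Φ) (f : F) : Set E :=
  {e | ∃ φ, L.edge φ = e ∧ L.face φ = f ∧ L.face (L.τ2 φ) ≠ f}

/-! ### Facts needed to see that the shrunk lattice is a lattice -/

section Facts

variable (L : Lattice V E F Φ)

lemma vert_τ1 (φ : Φ) : L.vert (L.τ1 φ) = L.vert φ :=
  ((L.vert_eq_iff _ _).2 (Relation.ReflTransGen.single (Or.inl rfl))).symm

lemma vert_τ2 (φ : Φ) : L.vert (L.τ2 φ) = L.vert φ :=
  ((L.vert_eq_iff _ _).2 (Relation.ReflTransGen.single (Or.inr rfl))).symm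

lemma edge_τ0 (φ : Φ) : L.edge (L.τ0 φ) = L.edge φ :=
  ((L.edge_eq_iff _ _).2 (Relation.ReflTransGen.single (Or.inl rfl))).symm

lemma edge_τ2 (φ : Φ) : L.edge (L.τ2 φ) = L.edge φ :=
  ((L.edge_eq_iff _ _).2 (Relation.ReflTransGen.single (Or.inr rfl))).symm

lemma face_τ0 (φ : Φ) : L.face (L.τ0 φ) = L.face φ :=
  ((L.face_eq_iff _ _).2 (Relation.ReflTransGen.single (Or.inl rfl))).symm

lemma face_τ1 (φ : Φ) : L.face (L.τ1 φ) = L.face φ :=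
  ((L.face_eq_iff _ _).2 (Relation.ReflTransGen.single (Or.inr rfl))).symm

variable {L}

lemma card_le_of_closed (h3 : L.ThreeValent) (φ : Φ) (T : Finset Φ) (hφ : φ ∈ T)
    (h1 : ∀ x ∈ T, L.τ1 x ∈ T) (h2 : ∀ x ∈ T, L.τ2 x ∈ T) : 6 ≤ T.card := by
  have hsub : ∀ x, L.vert x = L.vert φ → x ∈ T := by
    intro x hx
    have h := (L.vert_eq_iff φ x).1 hx.symm
    unfold SameOrbit at h
    induction h with
    | refl => exact hφ
    | @tail b c hb hstep ih =>
      have hbv : L.vert b = L.vert φ := ((L.vert_eq_iff φ b).2 hb).symm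
      rcases hstep with rfl | rfl
      · exact h1 _ (ih hbv)
      · exact h2 _ (ih hbv)
  have h6 := h3 (L.vert φ)
  have := Nat.card_le_card_of_injective
    (fun x : {x : Φ // L.vert x = L.vert φ} => (⟨x.1, hsub x.1 x.2⟩ : T))
    (fun a b hab => Subtype.ext (by simpa using hab))
  rw [h6] at this
  simpa using this

lemma le_card_of_subset (h3 : L.ThreeValent) (φ : Φ) (T : Finset Φ)
    (hT : ∀ x ∈ T, L.vert x = L.vert φ) : T.card ≤ 6 := by
  have h6 := h3 (L.vert φ)
  have : Finite {x : Φ // L.vert x = L.vert φ} := Nat.finite_of_card_ne_zero (by omega)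
  have := Nat.card_le_card_of_injective
    (fun x : T => (⟨x.1, hT x.1 x.2⟩ : {x : Φ // L.vert x = L.vert φ}))
    (fun a b hab => Subtype.ext (by simpa using hab))
  rw [h6] at this
  simpa using this

/-- Around a 3-valent vertex, three rotations return to the start. -/
lemma braid (h3 : L.ThreeValent) (φ : Φ) :
    L.τ2 (L.τ1 (L.τ2 φ)) = L.τ1 (L.τ2 (L.τ1 φ)) := by
  classical
  by_contra hne
  have e1 := L.τ1_τ1
  have e2 := L.τ2_τ2
  have n1 := L.τ1_ne
  have n2 := L.τ2_ne
  have hA : L.τ2 φ ≠ L.τ1 φ := by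
    intro h
    have := card_le_of_closed h3 φ {φ, L.τ1 φ} (by simp)
      (by simp only [Finset.mem_insert, Finset.mem_singleton]; grind)
      (by simp only [Finset.mem_insert, Finset.mem_singleton]; grind)
    have := Finset.card_le_two (a := φ) (b := L.τ1 φ)
    omega
  have hB : L.τ1 (L.τ2 φ) ≠ L.τ2 (L.τ1 φ) := by
    intro h
    have := card_le_of_closed h3 φ {φ, L.τ1 φ, L.τ2 φ, L.τ1 (L.τ2 φ)} (by simp)
      (by simp only [Finset.mem_insert, Finset.mem_singleton]; grind)
      (by simp only [Finset.mem_insert, Finset.mem_singleton]; grind)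
    have := Finset.card_le_four (a := φ) (b := L.τ1 φ) (c := L.τ2 φ) (d := L.τ1 (L.τ2 φ))
    omega
  have hle := le_card_of_subset h3 φ {φ, L.τ1 φ, L.τ2 φ, L.τ1 (L.τ2 φ), L.τ2 (L.τ1 φ),
      L.τ2 (L.τ1 (L.τ2 φ)), L.τ1 (L.τ2 (L.τ1 φ))} (by
    simp only [Finset.mem_insert, Finset.mem_singleton]
    rintro x (rfl | rfl | rfl | rfl | rfl | rfl | rfl) <;> simp only [vert_τ1, vert_τ2])
  have hcard : ({φ, L.τ1 φ, L.τ2 φ, L.τ1 (L.τ2 φ), L.τ2 (L.τ1 φ),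
      L.τ2 (L.τ1 (L.τ2 φ)), L.τ1 (L.τ2 (L.τ1 φ))} : Finset Φ).card = 7 := by
    repeat rw [Finset.card_insert_of_notMem (by
      simp only [Finset.mem_insert, Finset.mem_singleton]; grind)]
    simp
  omega

variable {col : F → Color}

/-- The three faces around a vertex have three different colors. -/
lemma third_ne (h3 : L.ThreeValent) (hc : L.ProperColoring col) (φ : Φ) :
    col (L.face (L.τ2 φ)) ≠ col (L.face (L.τ2 (L.τ1 φ))) := by
  have h := hc (L.τ1 (L.τ2 φ))
  rw [braid h3, L.face_τ1, L.face_τ1] at h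
  exact h

lemma avoids_iff (c : Color) (φ : Φ) : L.Avoids col c (L.edge φ) ↔
    col (L.face φ) ≠ c ∧ col (L.face (L.τ2 φ)) ≠ c := by
  constructor
  · intro h
    exact ⟨h φ rfl, h _ (L.edge_τ2 φ)⟩
  · rintro ⟨h1, h2⟩ ψ hψ
    have h := (L.edge_eq_iff φ ψ).1 hψ.symm
    have key : ∀ ψ, SameOrbit L.τ0 L.τ2 φ ψ →
        col (L.face ψ) ≠ c ∧ col (L.face (L.τ2 ψ)) ≠ c := by
      intro ψ h
      unfold SameOrbit at h
      induction h with
      | refl => exact ⟨h1, h2⟩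
      | tail _ hstep ih =>
        rcases hstep with rfl | rfl
        · rw [← L.τ0_τ2, L.face_τ0, L.face_τ0]; exact ih
        · rw [L.τ2_τ2]; exact ih.symm
    exact (key ψ h).1

lemma color_three {x y z c : Color} (hxy : x ≠ y) (hxz : x ≠ z) (hyz : y ≠ z) :
    (x ≠ c ∧ y ≠ c) ↔ z = c := by
  cases x <;> cases y <;> cases z <;> cases c <;> simp_all

/-- The edge of `φ` avoids the color `c` iff the third face at its vertex has color `c`. -/
lemma avoids_iff_third (h3 : L.ThreeValent) (hc : L.ProperColoring col) (c : Color) (φ : Φ) :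
    L.Avoids col c (L.edge φ) ↔ col (L.face (L.τ2 (L.τ1 φ))) = c := by
  rw [avoids_iff]
  refine color_three (hc φ) ?_ (third_ne h3 hc φ)
  have := hc (L.τ1 φ)
  rwa [L.face_τ1] at this

lemma avoids_τ1_τ0_τ1 (h3 : L.ThreeValent) (hc : L.ProperColoring col) (c : Color) (φ : Φ)
    (h : L.Avoids col c (L.edge φ)) : L.Avoids col c (L.edge (L.τ1 (L.τ0 (L.τ1 φ)))) := by
  rw [avoids_iff_third h3 hc] at h ⊢
  rw [L.τ1_τ1, ← L.τ0_τ2, L.face_τ0]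
  exact h

/-- Exactly one of the two edges in a corner of a face of color different from `c` avoids `c`. -/
lemma avoids_τ1_iff (h3 : L.ThreeValent) (hc : L.ProperColoring col) (c : Color) (φ : Φ)
    (h : col (L.face φ) ≠ c) :
    L.Avoids col c (L.edge (L.τ1 φ)) ↔ ¬ L.Avoids col c (L.edge φ) := by
  rw [avoids_iff_third h3 hc, L.τ1_τ1, avoids_iff]
  tauto

end Facts

/-- The lattice obtained from a properly colored 3-valent lattice by shrinking the faces of color
`c`.  Its vertices are the faces of color `c`, its edges are the edges whose two faces have the two
colors different from `c`, and its faces are the faces of the two colors different from `c`.  The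
flags of the shrunk lattice are the flags of `L` on the edges that survive; the vertex of such a
flag is the face of color `c` at the corresponding end of the edge.  In a face, the next edge is
found by passing along one edge that is shrunk to a point. -/
def shrink (L : Lattice V E F Φ) (col : F → Color) (h3 : L.ThreeValent)
    (hc : L.ProperColoring col) (c : Color) :
    Lattice {f : F // col f = c} {e : E // L.Avoids col c e} {f : F // col f ≠ c}
      {φ : Φ // L.Avoids col c (L.edge φ)} where
  τ0 φ := ⟨L.τ0 φ.1, by rw [L.edge_τ0]; exact φ.2⟩
  τ1 φ := ⟨L.τ1 (L.τ0 (L.τ1 φ.1)), avoids_τ1_τ0_τ1 h3 hc c φ.1 φ.2⟩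
  τ2 φ := ⟨L.τ2 φ.1, by rw [L.edge_τ2]; exact φ.2⟩
  τ0_τ0 φ := Subtype.ext (L.τ0_τ0 _)
  τ1_τ1 φ := Subtype.ext (by simp only [L.τ1_τ1, L.τ0_τ0])
  τ2_τ2 φ := Subtype.ext (L.τ2_τ2 _)
  τ0_ne φ h := L.τ0_ne _ (congrArg Subtype.val h)
  τ1_ne φ h := by
    have h' := congrArg L.τ1 (congrArg Subtype.val h)
    simp only [L.τ1_τ1] at h'
    exact L.τ0_ne _ h'
  τ2_ne φ h := L.τ2_ne _ (congrArg Subtype.val h)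
  τ0_τ2 φ := Subtype.ext (L.τ0_τ2 _)
  τ0_ne_τ2 φ h := L.τ0_ne_τ2 _ (congrArg Subtype.val h)
  vert φ := ⟨L.face (L.τ2 (L.τ1 φ.1)), (avoids_iff_third h3 hc c φ.1).1 φ.2⟩
  edge φ := ⟨L.edge φ.1, φ.2⟩
  face φ := ⟨L.face φ.1, φ.2 φ.1 rfl⟩
  vert_surj := by
    rintro ⟨f, hf⟩
    obtain ⟨χ, rfl⟩ := L.face_surj f
    refine ⟨⟨L.τ1 (L.τ2 χ), ?_⟩, ?_⟩
    · rw [avoids_iff_third h3 hc, L.τ1_τ1, L.τ2_τ2]; exact hf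
    · simp only [L.τ1_τ1, L.τ2_τ2]
  edge_surj := by
    rintro ⟨e, he⟩
    obtain ⟨χ, rfl⟩ := L.edge_surj e
    exact ⟨⟨χ, he⟩, rfl⟩
  face_surj := by
    rintro ⟨f, hf⟩
    obtain ⟨χ, rfl⟩ := L.face_surj f
    by_cases h : L.Avoids col c (L.edge χ)
    · exact ⟨⟨χ, h⟩, rfl⟩
    · exact ⟨⟨L.τ1 χ, (avoids_τ1_iff h3 hc c χ hf).2 h⟩, Subtype.ext (L.face_τ1 χ)⟩
  vert_eq_iff := by
    intro φ ψ
    constructor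
    · intro h
      have h' := (L.face_eq_iff _ _).1 (congrArg Subtype.val h)
      have key : ∀ χ, SameOrbit L.τ0 L.τ1 (L.τ2 (L.τ1 φ.1)) χ →
          ∀ ω : {φ : Φ // L.Avoids col c (L.edge φ)}, L.τ2 (L.τ1 ω.1) = χ →
          Relation.ReflTransGen (fun x y : {φ : Φ // L.Avoids col c (L.edge φ)} =>
            y = ⟨L.τ1 (L.τ0 (L.τ1 x.1)), avoids_τ1_τ0_τ1 h3 hc c x.1 x.2⟩ ∨
            y = ⟨L.τ2 x.1, by rw [L.edge_τ2]; exact x.2⟩) φ ω := by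
        intro χ hχ
        unfold SameOrbit at hχ
        induction hχ with
        | refl =>
          intro ω hω
          have : ω = φ := Subtype.ext (by
            have := congrArg L.τ1 (congrArg L.τ2 hω)
            simpa only [L.τ1_τ1, L.τ2_τ2] using this)
          rw [this]
        | @tail a b _ hstep ih =>
          intro ω hω
          rcases hstep with hb | hb
          · refine (ih ⟨L.τ1 (L.τ0 (L.τ1 ω.1)), avoids_τ1_τ0_τ1 h3 hc c ω.1 ω.2⟩ ?_).tail
              (Or.inl ?_)
            · simp only [L.τ1_τ1]
              rw [← L.τ0_τ2, hω, hb, L.τ0_τ0]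
            · exact Subtype.ext (by simp only [L.τ1_τ1, L.τ0_τ0])
          · refine (ih ⟨L.τ2 ω.1, by rw [L.edge_τ2]; exact ω.2⟩ ?_).tail (Or.inr ?_)
            · rw [braid h3, hω, hb, L.τ1_τ1]
            · exact Subtype.ext (L.τ2_τ2 _).symm
      exact key _ h' ψ rfl
    · intro h
      unfold SameOrbit at h
      induction h with
      | refl => rfl
      | tail _ hstep ih =>
        rw [ih]
        rcases hstep with rfl | rfl
        · refine Subtype.ext ?_
          simp only [L.τ1_τ1]
          rw [← L.τ0_τ2, L.face_τ0]
        · refine Subtype.ext ?_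
          simp only
          rw [braid h3, L.face_τ1]
  edge_eq_iff := by
    intro φ ψ
    constructor
    · intro h
      have h' := (L.edge_eq_iff _ _).1 (congrArg Subtype.val h)
      have key : ∀ χ, SameOrbit L.τ0 L.τ2 φ.1 χ →
          ∀ ω : {φ : Φ // L.Avoids col c (L.edge φ)}, ω.1 = χ →
          Relation.ReflTransGen (fun x y : {φ : Φ // L.Avoids col c (L.edge φ)} =>
            y = ⟨L.τ0 x.1, by rw [L.edge_τ0]; exact x.2⟩ ∨
            y = ⟨L.τ2 x.1, by rw [L.edge_τ2]; exact x.2⟩) φ ω := by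
        intro χ hχ
        unfold SameOrbit at hχ
        induction hχ with
        | refl =>
          intro ω hω
          rw [Subtype.ext hω]
        | @tail a b _ hstep ih =>
          intro ω hω
          rcases hstep with hb | hb
          · refine (ih ⟨L.τ0 ω.1, by rw [L.edge_τ0]; exact ω.2⟩ ?_).tail (Or.inl ?_)
            · change L.τ0 ω.1 = a
              rw [hω, hb, L.τ0_τ0]
            · exact Subtype.ext (L.τ0_τ0 _).symm
          · refine (ih ⟨L.τ2 ω.1, by rw [L.edge_τ2]; exact ω.2⟩ ?_).tail (Or.inr ?_)
            · change L.τ2 ω.1 = a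
              rw [hω, hb, L.τ2_τ2]
            · exact Subtype.ext (L.τ2_τ2 _).symm
      exact key _ h' ψ rfl
    · intro h
      unfold SameOrbit at h
      induction h with
      | refl => rfl
      | tail _ hstep ih =>
        rw [ih]
        rcases hstep with rfl | rfl
        · exact Subtype.ext (L.edge_τ0 _).symm
        · exact Subtype.ext (L.edge_τ2 _).symm
  face_eq_iff := by
    intro φ ψ
    constructor
    · intro h
      have h' := (L.face_eq_iff _ _).1 (congrArg Subtype.val h)
      have key : ∀ χ, SameOrbit L.τ0 L.τ1 φ.1 χ →
          ∀ ω : {φ : Φ // L.Avoids col c (L.edge φ)}, (ω.1 = χ ∨ L.τ1 ω.1 = χ) →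
          Relation.ReflTransGen (fun x y : {φ : Φ // L.Avoids col c (L.edge φ)} =>
            y = ⟨L.τ0 x.1, by rw [L.edge_τ0]; exact x.2⟩ ∨
            y = ⟨L.τ1 (L.τ0 (L.τ1 x.1)), avoids_τ1_τ0_τ1 h3 hc c x.1 x.2⟩) φ ω := by
        intro χ hχ
        unfold SameOrbit at hχ
        induction hχ with
        | refl =>
          rintro ω (hω | hω)
          · rw [Subtype.ext hω]
          · exfalso
            have h1 := φ.2
            rw [← hω, avoids_τ1_iff h3 hc c ω.1 (ω.2 ω.1 rfl)] at h1
            exact h1 ω.2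
        | @tail a b _ hstep ih =>
          rintro ω (hω | hω)
          · rcases hstep with hb | hb
            · refine (ih ⟨L.τ0 ω.1, by rw [L.edge_τ0]; exact ω.2⟩ (Or.inl ?_)).tail (Or.inl ?_)
              · change L.τ0 ω.1 = a
                rw [hω, hb, L.τ0_τ0]
              · exact Subtype.ext (L.τ0_τ0 _).symm
            · exact ih ω (Or.inr (by rw [hω, hb, L.τ1_τ1]))
          · rcases hstep with hb | hb
            · refine (ih ⟨L.τ1 (L.τ0 (L.τ1 ω.1)), avoids_τ1_τ0_τ1 h3 hc c ω.1 ω.2⟩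
                (Or.inr ?_)).tail (Or.inr ?_)
              · simp only [L.τ1_τ1]
                rw [hω, hb, L.τ0_τ0]
              · exact Subtype.ext (by simp only [L.τ1_τ1, L.τ0_τ0])
            · refine ih ω (Or.inl ?_)
              have := congrArg L.τ1 hω
              rwa [hb, L.τ1_τ1, L.τ1_τ1] at this
      exact key _ h' ψ (Or.inl rfl)
    · intro h
      unfold SameOrbit at h
      induction h with
      | refl => rfl
      | tail _ hstep ih =>
        rw [ih]
        rcases hstep with rfl | rfl
        · exact Subtype.ext (L.face_τ0 _).symm
        · refine Subtype.ext ?_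
          simp only [L.face_τ1, L.face_τ0]

end Lattice

/-! ### Qubits, Pauli operators and Clifford unitaries -/

/-- Linear maps from the Hilbert space of qubits labelled by `Q'` to the one of qubits labelled by
`Q`, as matrices with respect to the computational bases. -/
abbrev Op (Q Q' : Type*) := Matrix (Q → Fin 2) (Q' → Fin 2) ℂ

/-- The Pauli matrix `X`. -/
def σX : Matrix (Fin 2) (Fin 2) ℂ := !![0, 1; 1, 0]

/-- The Pauli matrix `Y`. -/
def σY : Matrix (Fin 2) (Fin 2) ℂ := !![0, -Complex.I; Complex.I, 0]

/-- The Pauli matrix `Z`. -/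
def σZ : Matrix (Fin 2) (Fin 2) ℂ := !![1, 0; 0, -1]

/-- The tensor product of the one-qubit operators `M q`. -/
def tensorPow {Q : Type*} [Fintype Q] (M : Q → Matrix (Fin 2) (Fin 2) ℂ) : Op Q Q :=
  Matrix.of fun x y => ∏ q, M q (x q) (y q)

open scoped Classical in
/-- The operator `P` on every qubit in the set `S`, the identity on the others. -/
def onSet {Q : Type*} [Fintype Q] (P : Matrix (Fin 2) (Fin 2) ℂ) (S : Set Q) : Op Q Q :=
  tensorPow fun q => if q ∈ S then P else 1

/-- The Pauli group: tensor products of Pauli matrices, with phases `1, i, -1, -i`. -/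
def pauliGroup (Q : Type*) [Fintype Q] : Set (Op Q Q) :=
  {M | ∃ (ω : ℂ) (P : Q → Matrix (Fin 2) (Fin 2) ℂ), ω ^ 4 = 1 ∧
    (∀ q, P q = 1 ∨ P q = σX ∨ P q = σY ∨ P q = σZ) ∧ M = ω • tensorPow P}

/-- `U` is a Clifford unitary from the space of the qubits `Q'` to the space of the qubits `Q`:
a unitary map that takes Pauli operators to Pauli operators by conjugation. -/
def IsClifford {Q Q' : Type*} [Fintype Q] [Fintype Q'] [DecidableEq Q] [DecidableEq Q']
    (U : Op Q Q') : Prop :=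
  U * U.conjTranspose = 1 ∧ U.conjTranspose * U = 1 ∧
    ∀ M ∈ pauliGroup Q', U * M * U.conjTranspose ∈ pauliGroup Q

section Generators

lemma tensorPow_one {Q : Type*} [Fintype Q] : tensorPow (fun _ : Q => (1 : Matrix (Fin 2) (Fin 2) ℂ)) = 1 := by
  ext x y
  simp only [tensorPow, Matrix.of_apply, Matrix.one_apply, Finset.prod_ite_zero, Finset.mem_univ,
    true_implies, Finset.prod_const_one, funext_iff]

variable {Q : Type*} [Fintype Q] [DecidableEq Q]

lemma tensorPow_mul (M N : Q → Matrix (Fin 2) (Fin 2) ℂ) :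
    tensorPow M * tensorPow N = tensorPow fun q => M q * N q := by
  ext x y
  simp only [tensorPow, Matrix.mul_apply, Matrix.of_apply]
  rw [Finset.prod_univ_sum, Fintype.piFinset_univ]
  simp only [Finset.prod_mul_distrib]

lemma onSet_mul_self {P : Matrix (Fin 2) (Fin 2) ℂ} (hP : P * P = 1) (S : Set Q) :
    onSet P S * onSet P S = 1 := by
  rw [onSet, tensorPow_mul, ← tensorPow_one]
  congr 1
  funext q
  split_ifs <;> simp [hP]

lemma σX_mul_self : σX * σX = 1 := by
  simp [σX, Matrix.one_fin_two]

lemma σZ_mul_self : σZ * σZ = 1 := by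
  simp [σZ, Matrix.one_fin_two]

/-- The operator `⨂_{q ∈ S} X(q)` as an invertible operator. -/
def XOn (S : Set Q) : (Op Q Q)ˣ :=
  ⟨onSet σX S, onSet σX S, onSet_mul_self σX_mul_self S, onSet_mul_self σX_mul_self S⟩

/-- The operator `⨂_{q ∈ S} Z(q)` as an invertible operator. -/
def ZOn (S : Set Q) : (Op Q Q)ˣ :=
  ⟨onSet σZ S, onSet σZ S, onSet_mul_self σZ_mul_self S, onSet_mul_self σZ_mul_self S⟩

end Generators

/-! ### The two codes -/

/-- The stabilizer group of the color code: qubits on vertices, `X` and `Z` generators on faces. -/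
def colorCode {V E F Φ : Type*} [Fintype V] [DecidableEq V] (L : Lattice V E F Φ) :
    Subgroup (Op V V)ˣ :=
  Subgroup.closure
    (Set.range (fun f : F => XOn (L.faceVerts f)) ∪ Set.range (fun f : F => ZOn (L.faceVerts f)))

/-- The stabilizer group of the toric code: qubits on edges, `X` generators on vertices, `Z`
generators on faces.  The generator of a vertex has one factor `X(e)` for each end of an edge `e` at
this vertex, so a loop contributes `X(e)² = 1`; similarly for a face which lies on both sides of an
edge. -/
def toricCode {V E F Φ : Type*} [Fintype E] [DecidableEq E] (L : Lattice V E F Φ) :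
    Subgroup (Op E E)ˣ :=
  Subgroup.closure
    (Set.range (fun v : V => XOn (L.coboundary v)) ∪ Set.range (fun f : F => ZOn (L.boundary f)))

/-- The operators in a group of invertible operators. -/
def ops {Q : Type*} [Fintype Q] [DecidableEq Q] (G : Subgroup (Op Q Q)ˣ) : Set (Op Q Q) :=
  {M | ∃ g ∈ G, (g : Op Q Q) = M}

/-- The tensor product of operators on two disjoint sets of qubits. -/
def tensor {Q R : Type*} (M : Op Q Q) (N : Op R R) : Op (Q ⊕ R) (Q ⊕ R) :=
  Matrix.of fun x y =>
    M (fun q => x (Sum.inl q)) (fun q => y (Sum.inl q)) *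
      N (fun r => x (Sum.inr r)) (fun r => y (Sum.inr r))

/-- The tensor product `G ⊗ H` of stabilizer groups on two disjoint sets of qubits. -/
def tensorGroup {Q R : Type*} [Fintype Q] [DecidableEq Q] [Fintype R] [DecidableEq R]
    (G : Subgroup (Op Q Q)ˣ) (H : Subgroup (Op R R)ˣ) : Set (Op (Q ⊕ R) (Q ⊕ R)) :=
  {T | ∃ M ∈ ops G, ∃ N ∈ ops H, T = tensor M N}

/-! ### Products of unitaries over the faces of one color -/

section Faces

variable {V E F Φ : Type*}

/-- The qubits of the two toric codes: the edges of the lattices obtained by shrinking the faces of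
color `A` and of color `B`, i.e. the `BC` edges and the `AC` edges. -/
abbrev ToricQubits (L : Lattice V E F Φ) (col : F → Color) :=
  {e : E // L.Avoids col Color.A e} ⊕ {e : E // L.Avoids col Color.B e}

/-- The edge that carries a qubit of the two toric codes. -/
def ToricQubits.edge {L : Lattice V E F Φ} {col : F → Color} : ToricQubits L col → E :=
  Sum.elim Subtype.val Subtype.val

/-- The qubits of the color code on the face `f`: its vertices. -/
abbrev VertsOn (L : Lattice V E F Φ) (f : F) := {v : V // v ∈ L.faceVerts f}

/-- The qubits of the two toric codes on the face `f`: those on its edges. -/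
abbrev EdgesOn (L : Lattice V E F Φ) (col : F → Color) (f : F) :=
  {q : ToricQubits L col // ToricQubits.edge q ∈ L.faceEdges f}

open scoped Classical in
/-- The tensor product `⨂_f U_f` over the faces `f` of color `C`, where `U_f` maps the space of the
qubits on the vertices of `f` to the space of the qubits on the edges of `f`. -/
def tensorOverC [Fintype F] (L : Lattice V E F Φ) (col : F → Color)
    (U : ∀ f : {f : F // col f = Color.C}, Op (EdgesOn L col f.1) (VertsOn L f.1)) :
    Op (ToricQubits L col) V :=
  Matrix.of fun x y => ∏ f, U f (fun q => x q.1) (fun v => y v.1)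

end Faces

end ColorCode

end

noncomputable section

set_option linter.unusedSectionVars false

namespace ColorCode

open Finset

/-! ### Products of operators -/

/-! The three faces at a vertex carry the three colors. Hence the boundary of a `C` face is an even
cycle with alternating `AC` and `BC` edges. Every vertex and every qubit of the two toric codes
belongs to exactly one such cycle (`Lattice.cycles`). Everything reduces to one Clifford unitary for
a system of even cycles, plus a comparison of incidences.

For bits `y` on the vertices, `δ y` records the sum over the two ends of each edge. Since the edges
of either type match up the vertices of a cycle, the two parities `A` and `B` of `δ y` on a cycle
coincide; `δ` forgets only the value of `y` at one marked vertex per cycle. So sending `Z Z` on the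
ends of an edge to `Z` on that edge cannot work literally: the two products of `Z` over the edges of
either type are independent, but both would come from `Z(f)`. The repair is `corr`, which adds the
parity of each type to an edge of the other type at the marked vertex. Then `x + corr (A x) (B x)`
has equal parities. The unitary connects `y` to the `x` with `δ y = x + corr (A x) (B x)`. Given
`y`, these `x` are parametrized by one free bit per cycle, `B x`, and this bit is coupled to `y` at
the marked vertex by a Hadamard sign. Unitarity is orthogonality of characters
(`conjTranspose_mul_unitary`). The compatibility relation and the amplitude factor over the cycles,
so the unitary is a tensor product (`unitary_eq_prod`).

Pauli operators are moved through the unitary by shifting along the linear compatibility relation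
(`unitary_mul_Xop_of_compat`, `unitary_mul_Zop_of_compat`, `unitary_mul_Zop_root`). `X` on a `C`
face becomes `Z` on its `BC` edges, a face generator of the first toric code. Every other generator
of the color code becomes a toric generator times a product of `Z` generators of `C` faces. This
system is triangular, so the two groups contain each other (`map_colorCode_le`, `le_map_colorCode`).
-/

lemma Op.mul_assoc {P Q R T : Type*} [Fintype Q] [DecidableEq Q] [Fintype R] [DecidableEq R]
    (L : Op P Q) (M : Op Q R) (N : Op R T) : L * M * N = L * (M * N) :=
  Matrix.mul_assoc L M N

lemma Op.mul_one {P Q : Type*} [Fintype Q] [DecidableEq Q] (M : Op P Q) : M * (1 : Op Q Q) = M :=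
  Matrix.mul_one M

lemma Op.one_mul {P Q : Type*} [Fintype P] [DecidableEq P] (M : Op P Q) : (1 : Op P P) * M = M :=
  Matrix.one_mul M

/-! ### Pauli operators indexed by binary vectors -/

lemma bit_add_self (a : Fin 2) : a + a = 0 := by revert a; decide

lemma bits_add_self {Q : Type*} (s : Q → Fin 2) : s + s = 0 := funext fun q => bit_add_self (s q)

lemma bits_add_cancel {Q : Type*} (s t : Q → Fin 2) : s + t + t = s := by
  rw [add_assoc, bits_add_self, add_zero]

lemma bits_eq_add_iff {Q : Type*} {s t r : Q → Fin 2} : s = t + r ↔ t = s + r := by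
  constructor <;> rintro rfl <;> rw [bits_add_cancel]

lemma bit_add_mul (a b c : Fin 2) : (a + b) * c = a * c + b * c := by revert a b c; decide

lemma bit_mul_add (a b c : Fin 2) : a * (b + c) = a * b + a * c := by revert a b c; decide

/-- The sign `(-1)^a`. -/
def sgn (a : Fin 2) : ℂ := if a = 0 then 1 else -1

@[simp] lemma sgn_zero : sgn 0 = 1 := rfl

@[simp] lemma sgn_one : sgn 1 = -1 := rfl

lemma sgn_add (a b : Fin 2) : sgn (a + b) = sgn a * sgn b := by
  fin_cases a <;> fin_cases b <;> simp [sgn]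

lemma star_sgn (a : Fin 2) : star (sgn a) = sgn a := by
  fin_cases a <;> simp [sgn]

lemma sgn_sum {ι : Type*} (s : Finset ι) (f : ι → Fin 2) :
    sgn (∑ i ∈ s, f i) = ∏ i ∈ s, sgn (f i) := by
  classical
  induction s using Finset.induction_on with
  | empty => simp
  | insert a s ha ih => rw [sum_insert ha, prod_insert ha, sgn_add, ih]

open scoped Classical in
/-- The indicator vector of a set of qubits. -/
def ind {Q : Type*} (S : Set Q) : Q → Fin 2 := fun q => if q ∈ S then 1 else 0

/-- The bilinear pairing of binary vectors. -/
def dot {Q : Type*} [Fintype Q] (r x : Q → Fin 2) : Fin 2 := ∑ q, r q * x q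

section Dot

variable {Q : Type*} [Fintype Q]

lemma dot_add (r x y : Q → Fin 2) : dot r (x + y) = dot r x + dot r y := by
  simp only [dot, Pi.add_apply, bit_mul_add, sum_add_distrib]

lemma add_dot (r s x : Q → Fin 2) : dot (r + s) x = dot r x + dot s x := by
  simp only [dot, Pi.add_apply, bit_add_mul, sum_add_distrib]

lemma zero_dot (x : Q → Fin 2) : dot 0 x = 0 := by
  simp [dot]

lemma sum_dot {ι : Type*} (s : Finset ι) (r : ι → Q → Fin 2) (x : Q → Fin 2) :
    dot (∑ i ∈ s, r i) x = ∑ i ∈ s, dot (r i) x := by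
  classical
  induction s using Finset.induction_on with
  | empty => simp [zero_dot]
  | insert a s ha ih => rw [sum_insert ha, sum_insert ha, add_dot, ih]

open scoped Classical in
lemma ind_dot (S : Set Q) (x : Q → Fin 2) : dot (ind S) x = ∑ q, if q ∈ S then x q else 0 := by
  refine sum_congr rfl fun q _ => ?_
  by_cases h : q ∈ S <;> simp [ind, h]

lemma ind_singleton_dot (q : Q) (x : Q → Fin 2) : dot (ind {q}) x = x q := by
  classical
  rw [ind_dot]
  simp

end Dot

lemma eq_ind {Q : Type*} (s : Q → Fin 2) : s = ind {q | s q = 1} := by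
  funext q
  have h : ∀ a : Fin 2, a ≠ 1 → a = 0 := by decide
  by_cases hq : s q = 1
  · simp [ind, hq]
  · simp [ind, h _ hq]

section Ops

variable {Q : Type*} [Fintype Q] [DecidableEq Q]

/-- The Pauli operator `⨂ X^{s q}`. -/
def Xop (s : Q → Fin 2) : Op Q Q := Matrix.of fun x y => if x = y + s then 1 else 0

/-- The Pauli operator `⨂ Z^{r q}`. -/
def Zop (r : Q → Fin 2) : Op Q Q := Matrix.diagonal fun x => sgn (dot r x)

lemma onSet_σX (S : Set Q) : onSet σX S = Xop (ind S) := by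
  classical
  ext x y
  simp only [onSet, tensorPow, Matrix.of_apply, Xop]
  have h : ∀ q, (if q ∈ S then σX else 1) (x q) (y q)
      = if x q = y q + ind S q then (1 : ℂ) else 0 := by
    intro q
    by_cases hq : q ∈ S <;> simp only [hq, if_true, if_false, ind] <;> generalize x q = a <;>
      generalize y q = b <;> fin_cases a <;> fin_cases b <;> simp [σX]
  rw [prod_congr rfl fun q _ => h q, prod_ite_zero]
  simp [funext_iff]

lemma onSet_σZ (S : Set Q) : onSet σZ S = Zop (ind S) := by
  classical
  ext x y
  simp only [onSet, tensorPow, Matrix.of_apply, Zop, Matrix.diagonal_apply]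
  have h : ∀ q, (if q ∈ S then σZ else 1) (x q) (y q)
      = if x q = y q then sgn (ind S q * x q) else 0 := by
    intro q
    by_cases hq : q ∈ S <;> simp only [hq, if_true, if_false, ind] <;> generalize x q = a <;>
      generalize y q = b <;> fin_cases a <;> fin_cases b <;> simp [σZ]
  rw [prod_congr rfl fun q _ => h q, prod_ite_zero]
  simp [funext_iff, dot, sgn_sum]

lemma Xop_zero : Xop (0 : Q → Fin 2) = 1 := by
  ext x y
  simp [Xop, Matrix.one_apply]

lemma Zop_zero : Zop (0 : Q → Fin 2) = 1 := by
  simp [Zop, zero_dot]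

variable {R : Type*} [Fintype R] [DecidableEq R]

lemma Xop_mul_apply (s : Q → Fin 2) (U : Op Q R) (x : Q → Fin 2) (y : R → Fin 2) :
    (Xop s * U) x y = U (x + s) y := by
  simp only [Xop, Matrix.mul_apply, Matrix.of_apply]
  rw [Finset.sum_eq_single (x + s)]
  · simp [bits_add_cancel]
  · intro z _ hz
    rw [if_neg (fun h => hz (bits_eq_add_iff.1 h)), zero_mul]
  · simp

lemma mul_Xop_apply (s : R → Fin 2) (U : Op Q R) (x : Q → Fin 2) (y : R → Fin 2) :
    (U * Xop s) x y = U x (y + s) := by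
  simp [Xop, Matrix.mul_apply, Matrix.of_apply]

lemma Zop_mul_apply (r : Q → Fin 2) (U : Op Q R) (x : Q → Fin 2) (y : R → Fin 2) :
    (Zop r * U) x y = sgn (dot r x) * U x y := by
  simp [Zop, Matrix.diagonal_mul]

lemma mul_Zop_apply (r : R → Fin 2) (U : Op Q R) (x : Q → Fin 2) (y : R → Fin 2) :
    (U * Zop r) x y = U x y * sgn (dot r y) := by
  simp [Zop, Matrix.mul_diagonal]

lemma Xop_add (s t : Q → Fin 2) : Xop (s + t) = Xop s * Xop t := by
  ext x y
  rw [Xop_mul_apply]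
  simp only [Xop, Matrix.of_apply]
  congr 1
  rw [bits_eq_add_iff, bits_eq_add_iff (s := x + s), add_assoc]

lemma Zop_add (s t : Q → Fin 2) : Zop (s + t) = Zop s * Zop t := by
  simp [Zop, Matrix.diagonal_mul_diagonal, add_dot, sgn_add]

/-! ### The Pauli group -/

/-- One of the four Pauli matrices. -/
def IsPauliMatrix (P : Matrix (Fin 2) (Fin 2) ℂ) : Prop := P = 1 ∨ P = σX ∨ P = σY ∨ P = σZ

lemma tensorPow_smul (c : Q → ℂ) (P : Q → Matrix (Fin 2) (Fin 2) ℂ) :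
    tensorPow (fun q => c q • P q) = (∏ q, c q) • tensorPow P := by
  ext x y
  simp [tensorPow, prod_mul_distrib]

lemma IsPauliMatrix.mul {P P' : Matrix (Fin 2) (Fin 2) ℂ} (h : IsPauliMatrix P)
    (h' : IsPauliMatrix P') : ∃ (c : ℂ) (P'' : Matrix (Fin 2) (Fin 2) ℂ), c ^ 4 = 1 ∧
      IsPauliMatrix P'' ∧ P * P' = c • P'' := by
  have hI : Complex.I ^ 4 = 1 := Complex.I_pow_four
  have hnI : (-Complex.I) ^ 4 = 1 := by rw [Even.neg_pow (by decide)]; exact hI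
  rcases h with rfl | rfl | rfl | rfl
  · exact ⟨1, P', by simp, h', by simp⟩
  all_goals rcases h' with rfl | rfl | rfl | rfl
  · exact ⟨1, σX, by simp, by simp [IsPauliMatrix], by simp⟩
  · exact ⟨1, 1, by simp, by simp [IsPauliMatrix], by simp [σX_mul_self]⟩
  · exact ⟨Complex.I, σZ, hI, by simp [IsPauliMatrix], by simp [σX, σY, σZ]⟩
  · exact ⟨-Complex.I, σY, hnI, by simp [IsPauliMatrix], by simp [σX, σY, σZ]⟩
  · exact ⟨1, σY, by simp, by simp [IsPauliMatrix], by simp⟩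
  · exact ⟨-Complex.I, σZ, hnI, by simp [IsPauliMatrix], by simp [σX, σY, σZ]⟩
  · exact ⟨1, 1, by simp, by simp [IsPauliMatrix], by simp [σY, Matrix.one_fin_two]⟩
  · exact ⟨Complex.I, σX, hI, by simp [IsPauliMatrix], by simp [σX, σY, σZ]⟩
  · exact ⟨1, σZ, by simp, by simp [IsPauliMatrix], by simp⟩
  · exact ⟨Complex.I, σY, hI, by simp [IsPauliMatrix], by simp [σX, σY, σZ]⟩
  · exact ⟨-Complex.I, σX, hnI, by simp [IsPauliMatrix], by simp [σX, σY, σZ]⟩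
  · exact ⟨1, 1, by simp, by simp [IsPauliMatrix], by simp [σZ_mul_self]⟩

lemma pauliGroup_mul {M N : Op Q Q} (hM : M ∈ pauliGroup Q) (hN : N ∈ pauliGroup Q) :
    M * N ∈ pauliGroup Q := by
  obtain ⟨ω, P, hω, hP, rfl⟩ := hM
  obtain ⟨ω', P', hω', hP', rfl⟩ := hN
  choose c P'' hc hP'' h using fun q => IsPauliMatrix.mul (hP q) (hP' q)
  refine ⟨ω * ω' * ∏ q, c q, P'', ?_, hP'', ?_⟩
  · rw [mul_pow, mul_pow, hω, hω', ← prod_pow]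
    simp [hc]
  · rw [Matrix.smul_mul, Matrix.mul_smul, tensorPow_mul]
    simp only [h]
    rw [tensorPow_smul, smul_smul, smul_smul, mul_assoc]

lemma pauliGroup_smul {M : Op Q Q} {c : ℂ} (hc : c ^ 4 = 1) (hM : M ∈ pauliGroup Q) :
    c • M ∈ pauliGroup Q := by
  obtain ⟨ω, P, hω, hP, rfl⟩ := hM
  exact ⟨c * ω, P, by rw [mul_pow, hc, hω, one_mul], hP, by rw [smul_smul]⟩

lemma Xop_mem_pauliGroup (s : Q → Fin 2) : Xop s ∈ pauliGroup Q := by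
  classical
  rw [eq_ind s, ← onSet_σX]
  refine ⟨1, _, by simp, fun q => ?_, by rw [one_smul]; rfl⟩
  split_ifs <;> simp

lemma Zop_mem_pauliGroup (s : Q → Fin 2) : Zop s ∈ pauliGroup Q := by
  classical
  rw [eq_ind s, ← onSet_σZ]
  refine ⟨1, _, by simp, fun q => ?_, by rw [one_smul]; rfl⟩
  split_ifs <;> simp

/-- Because `Y = i X Z`, a Pauli operator has a normal form given by two binary vectors and a phase,
so only `X` and `Z` operators need to be conjugated. -/
lemma exists_eq_smul_Xop_mul_Zop {M : Op Q Q} (hM : M ∈ pauliGroup Q) :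
    ∃ (c : ℂ) (s r : Q → Fin 2), c ^ 4 = 1 ∧ M = c • (Xop s * Zop r) := by
  classical
  obtain ⟨ω, P, hω, hP, rfl⟩ := hM
  have key : ∀ q, ∃ (c : ℂ) (a b : Prop), c ^ 4 = 1 ∧
      P q = c • ((if a then σX else 1) * (if b then σZ else 1)) := by
    intro q
    rcases hP q with h | h | h | h
    · exact ⟨1, False, False, by simp, by simp [h]⟩
    · exact ⟨1, True, False, by simp, by simp [h]⟩
    · exact ⟨Complex.I, True, True, Complex.I_pow_four, by simp [h, σX, σY, σZ]⟩
    · exact ⟨1, False, True, by simp, by simp [h]⟩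
  choose c a b hc h using key
  refine ⟨ω * ∏ q, c q, ind {q | a q}, ind {q | b q}, ?_, ?_⟩
  · rw [mul_pow, hω, ← prod_pow]
    simp [hc]
  · rw [← onSet_σX, ← onSet_σZ, onSet, onSet, tensorPow_mul, mul_smul, ← tensorPow_smul]
    congr 2
    funext q
    rw [h]
    rfl

/-- A unitary that takes the `X` operators and the one-qubit `Z` operators to Pauli operators is
Clifford. -/
lemma isClifford_of_generators {U : Op R Q} (h₁ : U * U.conjTranspose = 1)
    (h₂ : U.conjTranspose * U = 1) (hX : ∀ s : Q → Fin 2, ∃ N ∈ pauliGroup R, U * Xop s = N * U)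
    (hZ : ∀ q, ∃ N ∈ pauliGroup R, U * Zop (ind ({q} : Set Q)) = N * U) : IsClifford U := by
  classical
  have hZ' : ∀ T : Finset Q, ∃ N ∈ pauliGroup R, U * Zop (ind (T : Set Q)) = N * U := by
    intro T
    induction T using Finset.induction_on with
    | empty =>
      refine ⟨1, by rw [← Xop_zero]; exact Xop_mem_pauliGroup 0, ?_⟩
      have : ind ((∅ : Finset Q) : Set Q) = 0 := by funext q; simp [ind]
      rw [this, Zop_zero, Op.one_mul, Op.mul_one]
    | insert q T hq ih =>
      obtain ⟨N, hN, h⟩ := hZ q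
      obtain ⟨N', hN', h'⟩ := ih
      refine ⟨N * N', pauliGroup_mul hN hN', ?_⟩
      have : ind ((insert q T : Finset Q) : Set Q) = ind {q} + ind (T : Set Q) := by
        funext p
        by_cases hp : p = q
        · subst hp; simp [ind, hq]
        · simp [ind, hp]
      rw [this, Zop_add, ← Op.mul_assoc, h, Op.mul_assoc, h', Op.mul_assoc]
  refine ⟨h₁, h₂, fun M hM => ?_⟩
  obtain ⟨c, s, r, hc, rfl⟩ := exists_eq_smul_Xop_mul_Zop hM
  obtain ⟨N, hN, h⟩ := hX s
  obtain ⟨N', hN', h'⟩ := hZ' (univ.filter fun q => r q = 1)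
  have hr : ind ((univ.filter fun q => r q = 1 : Finset Q) : Set Q) = r := by
    rw [coe_filter_univ]; exact (eq_ind r).symm
  rw [hr] at h'
  have : U * c • (Xop s * Zop r) * U.conjTranspose = c • (N * N') := by
    rw [Matrix.mul_smul, Matrix.smul_mul, ← Op.mul_assoc, h, Op.mul_assoc N, h',
      Op.mul_assoc, Op.mul_assoc N', h₁, Op.mul_one]
  rw [this]
  exact pauliGroup_smul hc (pauliGroup_mul hN hN')

end Ops

/-! ### Disjoint unions of even cycles and their Clifford unitaries -/

/-- A disjoint union of cycles of even length with vertices `V`, edges `Q`, components `K`.  The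
edges are of two types, alternating along each cycle: every vertex `v` lies on one edge `α v` of the
first type and on one edge `β v` of the second type.  A vertex is marked in each component. -/
structure CycleSystem (V Q K : Type*) where
  α : V → Q
  β : V → Q
  snd : Q → Prop
  comp : Q → K
  root : K → V
  not_snd_α : ∀ v, ¬ snd (α v)
  snd_β : ∀ v, snd (β v)
  exists_α : ∀ q, ¬ snd q → ∃ v, α v = q
  exists_β : ∀ q, snd q → ∃ v, β v = q
  comp_β : ∀ v, comp (β v) = comp (α v)
  comp_root : ∀ k, comp (α (root k)) = k
  fiber_α : ∀ v, ∃ w, w ≠ v ∧ ∀ u, α u = α v ↔ u = v ∨ u = w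
  fiber_β : ∀ v, ∃ w, w ≠ v ∧ ∀ u, β u = β v ↔ u = v ∨ u = w
  induct : ∀ P : V → Prop, (∀ k, P (root k)) → (∀ v w, α v = α w → P v → P w) →
    (∀ v w, β v = β w → P v → P w) → ∀ v, P v

namespace CycleSystem

variable {V Q K : Type*} [Fintype V] [DecidableEq V] [Fintype Q] [DecidableEq Q] [Fintype K]
  [DecidableEq K] (S : CycleSystem V Q K)

open scoped Classical in
/-- The sum of the bits at the two ends of an edge. -/
def δ (y : V → Fin 2) (q : Q) : Fin 2 :=
  (∑ v, if S.α v = q then y v else 0) + ∑ v, if S.β v = q then y v else 0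

/-- The edges of the first type in the component `k`. -/
def fstEdges (k : K) : Set Q := {q | ¬ S.snd q ∧ S.comp q = k}

/-- The edges of the second type in the component `k`. -/
def sndEdges (k : K) : Set Q := {q | S.snd q ∧ S.comp q = k}

/-- The vertices of the component `k`. -/
def verts (k : K) : Set V := {v | S.comp (S.α v) = k}

open scoped Classical in
/-- The correction term at the two edges of each marked vertex. -/
def corr (a b : K → Fin 2) (q : Q) : Fin 2 :=
  (if q = S.α (S.root (S.comp q)) then b (S.comp q) else 0) +
    if q = S.β (S.root (S.comp q)) then a (S.comp q) else 0

/-- The parity of `x` on the edges of the first type in each component. -/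
def A (x : Q → Fin 2) (k : K) : Fin 2 := dot (ind (S.fstEdges k)) x

/-- The parity of `x` on the edges of the second type in each component. -/
def B (x : Q → Fin 2) (k : K) : Fin 2 := dot (ind (S.sndEdges k)) x

/-- The parity of `y` in each component. -/
def par (y : V → Fin 2) (k : K) : Fin 2 := dot (ind (S.verts k)) y

/-- The pairs `x`, `y` of basis vectors between which the unitary has a nonzero entry. -/
def Compat (x : Q → Fin 2) (y : V → Fin 2) : Prop :=
  ∀ q, S.δ y q = x q + S.corr (S.A x) (S.B x) q

open scoped Classical in
/-- The Clifford unitary of a system of cycles. -/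
def unitary : Op Q V := Matrix.of fun x y =>
  if S.Compat x y then ∏ k, ((√2 : ℝ) : ℂ)⁻¹ * sgn (S.B x k * y (S.root k)) else 0

/-- The parametrization of the `x` compatible with a given `y`. -/
def ext (y : V → Fin 2) (b : K → Fin 2) : Q → Fin 2 := S.δ y + S.corr (b + S.par y) b

/-! ### Linear algebra of edge differences, parities and corrections. -/

lemma A_add (x x' : Q → Fin 2) : S.A (x + x') = S.A x + S.A x' := funext fun _ => dot_add _ _ _

lemma B_add (x x' : Q → Fin 2) : S.B (x + x') = S.B x + S.B x' := funext fun _ => dot_add _ _ _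

lemma δ_add (y y' : V → Fin 2) : S.δ (y + y') = S.δ y + S.δ y' := by
  classical
  funext q
  have h : ∀ (p : Prop) [Decidable p] (a b : Fin 2), (if p then a + b else 0)
      = (if p then a else 0) + if p then b else 0 := by
    intro p _ a b; split_ifs <;> simp
  simp only [δ, Pi.add_apply, h, sum_add_distrib]
  abel

lemma corr_add (a a' b b' : K → Fin 2) : S.corr (a + a') (b + b') = S.corr a b + S.corr a' b' := by
  funext q
  simp only [corr, Pi.add_apply]
  split_ifs <;> abel

lemma α_ne_β (v w : V) : S.α v ≠ S.β w := fun h => S.not_snd_α v (h ▸ S.snd_β w)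

open scoped Classical in
-- Exchange of summation: each vertex lies on exactly one edge of the first type, and the edges of
-- the second type do not meet `R`.
lemma sum_δ_of_not_snd {R : Set Q} (hR : ∀ q ∈ R, ¬ S.snd q) (y : V → Fin 2) :
    dot (ind R) (S.δ y) = ∑ v, if S.α v ∈ R then y v else 0 := by
  rw [ind_dot]
  have : ∀ q, (if q ∈ R then S.δ y q else 0) =
      ∑ v, if S.α v = q then (if S.α v ∈ R then y v else 0) else 0 := by
    intro q
    by_cases hq : q ∈ R
    · rw [if_pos hq, δ]
      have h0 : (∑ v, if S.β v = q then y v else 0) = 0 :=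
        sum_eq_zero fun v _ => if_neg fun h : S.β v = q => hR q hq (h ▸ S.snd_β v)
      rw [h0, add_zero]
      refine sum_congr rfl fun v _ => ?_
      split_ifs with h1 h2 <;> first | rfl | exact absurd (h1 ▸ hq) h2
    · rw [if_neg hq]
      refine (sum_eq_zero fun v _ => ?_).symm
      split_ifs with h1 h2 <;> first | rfl | exact absurd (h1 ▸ h2) hq
  rw [sum_congr rfl fun q _ => this q, sum_comm]
  simp

open scoped Classical in
lemma sum_δ_of_snd {R : Set Q} (hR : ∀ q ∈ R, S.snd q) (y : V → Fin 2) :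
    dot (ind R) (S.δ y) = ∑ v, if S.β v ∈ R then y v else 0 := by
  rw [ind_dot]
  have : ∀ q, (if q ∈ R then S.δ y q else 0) =
      ∑ v, if S.β v = q then (if S.β v ∈ R then y v else 0) else 0 := by
    intro q
    by_cases hq : q ∈ R
    · rw [if_pos hq, δ]
      have h0 : (∑ v, if S.α v = q then y v else 0) = 0 :=
        sum_eq_zero fun v _ => if_neg fun h : S.α v = q => S.not_snd_α v (by rw [h]; exact hR q hq)
      rw [h0, zero_add]
      refine sum_congr rfl fun v _ => ?_
      split_ifs with h1 h2 <;> first | rfl | exact absurd (h1 ▸ hq) h2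
    · rw [if_neg hq]
      refine (sum_eq_zero fun v _ => ?_).symm
      split_ifs with h1 h2 <;> first | rfl | exact absurd (h1 ▸ h2) hq
  rw [sum_congr rfl fun q _ => this q, sum_comm]
  simp

/-- The edges of one type match up the vertices of each cycle. Together with `B_δ` this gives the
constraint on the image of `δ`: equal parities on both types. -/
lemma A_δ (y : V → Fin 2) : S.A (S.δ y) = S.par y := by
  classical
  funext k
  rw [A, S.sum_δ_of_not_snd (fun q hq => hq.1), par, ind_dot]
  exact sum_congr rfl fun v _ => if_congr (by simp [fstEdges, verts, S.not_snd_α]) rfl rfl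

lemma B_δ (y : V → Fin 2) : S.B (S.δ y) = S.par y := by
  classical
  funext k
  rw [B, S.sum_δ_of_snd (fun q hq => hq.1), par, ind_dot]
  exact sum_congr rfl fun v _ => if_congr (by simp [sndEdges, verts, S.snd_β, S.comp_β]) rfl rfl

open scoped Classical in
lemma dot_corr_of_not_snd {R : Set Q} (hR : ∀ q ∈ R, ¬ S.snd q) (a b : K → Fin 2) :
    dot (ind R) (S.corr a b) = ∑ k, if S.α (S.root k) ∈ R then b k else 0 := by
  rw [ind_dot]
  have : ∀ q, (if q ∈ R then S.corr a b q else 0) = ∑ k, if S.α (S.root k) = q then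
      (if S.α (S.root k) ∈ R then b k else 0) else 0 := by
    intro q
    by_cases hq : q ∈ R
    · rw [if_pos hq, corr,
        if_neg (fun h : q = S.β (S.root (S.comp q)) => hR q hq (h ▸ S.snd_β _)), add_zero,
        sum_eq_single (S.comp q)]
      · simp only [eq_comm (a := q)]
        split_ifs with h1 h2 <;> first | rfl | exact absurd (by rw [h1]; exact hq) h2
      · intro k _ hk
        exact if_neg fun h => hk (by rw [← h, S.comp_root])
      · simp
    · rw [if_neg hq]
      refine (sum_eq_zero fun v _ => ?_).symm
      split_ifs with h1 h2 <;> first | rfl | exact absurd (h1 ▸ h2) hq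
  rw [sum_congr rfl fun q _ => this q, sum_comm]
  simp

open scoped Classical in
lemma dot_corr_of_snd {R : Set Q} (hR : ∀ q ∈ R, S.snd q) (a b : K → Fin 2) :
    dot (ind R) (S.corr a b) = ∑ k, if S.β (S.root k) ∈ R then a k else 0 := by
  rw [ind_dot]
  have : ∀ q, (if q ∈ R then S.corr a b q else 0) = ∑ k, if S.β (S.root k) = q then
      (if S.β (S.root k) ∈ R then a k else 0) else 0 := by
    intro q
    by_cases hq : q ∈ R
    · rw [if_pos hq, corr,
        if_neg (fun h : q = S.α (S.root (S.comp q)) => S.not_snd_α _ (h ▸ hR q hq)), zero_add,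
        sum_eq_single (S.comp q)]
      · simp only [eq_comm (a := q)]
        split_ifs with h1 h2 <;> first | rfl | exact absurd (by rw [h1]; exact hq) h2
      · intro k _ hk
        exact if_neg fun h => hk (by rw [← h, S.comp_β, S.comp_root])
      · simp
    · rw [if_neg hq]
      refine (sum_eq_zero fun v _ => ?_).symm
      split_ifs with h1 h2 <;> first | rfl | exact absurd (h1 ▸ h2) hq
  rw [sum_congr rfl fun q _ => this q, sum_comm]
  simp

/-- In each component the correction meets the first type in a single edge, carrying `b`. The roles
of `a` and `b` are crossed so that correcting by `corr (A x) (B x)` turns both parities into `A x +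
B x`. -/
lemma A_corr (a b : K → Fin 2) : S.A (S.corr a b) = b := by
  classical
  funext k
  rw [A, S.dot_corr_of_not_snd (fun q hq => hq.1)]
  simp [fstEdges, S.not_snd_α, S.comp_root]

lemma B_corr (a b : K → Fin 2) : S.B (S.corr a b) = a := by
  classical
  funext k
  rw [B, S.dot_corr_of_snd (fun q hq => hq.1)]
  simp [sndEdges, S.snd_β, S.comp_β, S.comp_root]

lemma A_ext (y : V → Fin 2) (b : K → Fin 2) : S.A (S.ext y b) = b + S.par y := by
  rw [ext, A_add, A_δ, A_corr, add_comm]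

lemma B_ext (y : V → Fin 2) (b : K → Fin 2) : S.B (S.ext y b) = b := by
  rw [ext, B_add, B_δ, B_corr, add_comm, bits_add_cancel]

lemma compat_iff (x : Q → Fin 2) (y : V → Fin 2) :
    S.Compat x y ↔ S.δ y = x + S.corr (S.A x) (S.B x) := by
  rw [Compat, funext_iff]
  rfl

/-- Compatibility is a linear relation, so a compatible pair acts on the support of the unitary by
translation. All commutation rules with `X` operators come from this. -/
lemma compat_add {x x' : Q → Fin 2} {y y' : V → Fin 2} (h : S.Compat x y) (h' : S.Compat x' y') :
    S.Compat (x + x') (y + y') := by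
  rw [compat_iff] at *
  rw [δ_add, A_add, B_add, corr_add, h, h']
  abel

lemma compat_add_iff {x x' : Q → Fin 2} {y y' : V → Fin 2} (h' : S.Compat x' y') :
    S.Compat (x + x') (y + y') ↔ S.Compat x y := by
  refine ⟨fun h => ?_, fun h => S.compat_add h h'⟩
  have := S.compat_add h h'
  rwa [bits_add_cancel, bits_add_cancel] at this

lemma compat_ext (y : V → Fin 2) (b : K → Fin 2) : S.Compat (S.ext y b) y := by
  rw [compat_iff, A_ext, B_ext, ext, bits_add_cancel]

/-- Taking parities of `x = δ y + corr (A x) (B x)` expresses `A x` through `B x` and `y`; the bits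
`B x` are the only freedom left. -/
lemma eq_ext_of_compat {x : Q → Fin 2} {y : V → Fin 2} (h : S.Compat x y) :
    x = S.ext y (S.B x) := by
  have hx : x = S.δ y + S.corr (S.A x) (S.B x) := by
    rw [(S.compat_iff x y).1 h, bits_add_cancel]
  have hA : S.A x = S.B x + S.par y := by
    conv_lhs => rw [hx]
    rw [A_add, A_δ, A_corr, add_comm]
  rw [hA] at hx
  exact hx

lemma δ_α {v w : V} (hw : w ≠ v) (h : ∀ u, S.α u = S.α v ↔ u = v ∨ u = w) (y : V → Fin 2) :
    S.δ y (S.α v) = y v + y w := by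
  classical
  have h0 : (∑ u, if S.β u = S.α v then y u else 0) = 0 :=
    sum_eq_zero fun u _ => if_neg (S.α_ne_β v u).symm
  rw [δ, h0, add_zero]
  simp only [h]
  rw [← sum_filter, ← sum_pair (f := y) hw.symm]
  congr 1
  ext u
  simp

lemma δ_β {v w : V} (hw : w ≠ v) (h : ∀ u, S.β u = S.β v ↔ u = v ∨ u = w) (y : V → Fin 2) :
    S.δ y (S.β v) = y v + y w := by
  classical
  have h0 : (∑ u, if S.α u = S.β v then y u else 0) = 0 :=
    sum_eq_zero fun u _ => if_neg (S.α_ne_β u v)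
  rw [δ, h0, zero_add]
  simp only [h]
  rw [← sum_filter, ← sum_pair (f := y) hw.symm]
  congr 1
  ext u
  simp

/-- A vector is determined by its differences along the edges and its values at the marked
vertices. -/
lemma eq_of_δ_eq {y y' : V → Fin 2} (h : S.δ y = S.δ y') (hr : ∀ k, y (S.root k) = y' (S.root k)) :
    y = y' := by
  have aux : ∀ a b c d : Fin 2, a + b = c + d → a = c → b = d := by decide
  -- Equality spreads from the marked vertices along the edges: on an edge, the sum of the two end
  -- bits and one of them determine the other.
  funext v
  refine S.induct (fun v => y v = y' v) hr ?_ ?_ v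
  · intro v u hu hv
    obtain ⟨w, hw, hf⟩ := S.fiber_α v
    have hd := congrFun h (S.α v)
    rw [S.δ_α hw hf, S.δ_α hw hf] at hd
    rcases (hf u).1 hu.symm with rfl | rfl
    · exact hv
    · exact aux _ _ _ _ hd hv
  · intro v u hu hv
    obtain ⟨w, hw, hf⟩ := S.fiber_β v
    have hd := congrFun h (S.β v)
    rw [S.δ_β hw hf, S.δ_β hw hf] at hd
    rcases (hf u).1 hu.symm with rfl | rfl
    · exact hv
    · exact aux _ _ _ _ hd hv

/-- Each type of edge partitions the vertices into pairs, so each type has half as many edges as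
there are vertices. -/
lemma card_eq (S : CycleSystem V Q K) : Fintype.card V = Fintype.card Q := by
  classical
  have h1 : Fintype.card V = #{q : Q | ¬ S.snd q} * 2 := by
    rw [← card_univ, card_eq_sum_card_fiberwise (f := S.α) (t := {q : Q | ¬ S.snd q})
      (fun v _ => by simpa using S.not_snd_α v)]
    refine sum_const_nat fun q hq => ?_
    obtain ⟨v, rfl⟩ := S.exists_α q (by simpa using hq)
    obtain ⟨w, hw, hf⟩ := S.fiber_α v
    rw [← card_pair hw.symm]
    congr 1
    ext u
    simp [hf]
  have h2 : Fintype.card V = #{q : Q | S.snd q} * 2 := by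
    rw [← card_univ, card_eq_sum_card_fiberwise (f := S.β) (t := {q : Q | S.snd q})
      (fun v _ => by simpa using S.snd_β v)]
    refine sum_const_nat fun q hq => ?_
    obtain ⟨v, rfl⟩ := S.exists_β q (by simpa using hq)
    obtain ⟨w, hw, hf⟩ := S.fiber_β v
    rw [← card_pair hw.symm]
    congr 1
    ext u
    simp [hf]
  have h3 := card_filter_add_card_filter_not (s := (univ : Finset Q)) (fun q => S.snd q)
  rw [card_univ] at h3
  omega

/-! ### Unitarity. -/

lemma sqrt_two_inv_sq : ((√2 : ℝ) : ℂ)⁻¹ * ((√2 : ℝ) : ℂ)⁻¹ = 2⁻¹ := by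
  rw [← mul_inv, ← Complex.ofReal_mul, Real.mul_self_sqrt (by norm_num)]
  simp

lemma sum_sgn_mul (a : Fin 2) : ∑ b : Fin 2, 2⁻¹ * sgn (b * a) = if a = 0 then 1 else 0 := by
  fin_cases a <;> simp

lemma conjTranspose_mul_unitary : S.unitary.conjTranspose * S.unitary = 1 := by
  classical
  ext y y'
  have key : (S.unitary.conjTranspose * S.unitary) y y' =
      ∑ b : K → Fin 2, if S.δ y = S.δ y' then
        ∏ k, 2⁻¹ * sgn (b k * (y (S.root k) + y' (S.root k))) else 0 := by
    rw [Matrix.mul_apply]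
    simp only [Matrix.conjTranspose_apply, unitary, Matrix.of_apply]
    symm
    -- Only the `x` compatible with `y` contribute, and `ext y` parametrizes them bijectively by the
    -- free bits `b`. A common compatible `x` for `y` and `y'` forces equal edge differences.
    refine sum_of_injOn (S.ext y) ?_ (by simp) ?_ ?_
    · intro b _ b' _ h
      rw [← S.B_ext y b, ← S.B_ext y b', h]
    · intro x _ hx
      rw [if_neg, star_zero, zero_mul]
      intro h
      exact hx ⟨S.B x, by simp, (S.eq_ext_of_compat h).symm⟩
    · intro b _
      rw [if_pos (S.compat_ext y b)]
      by_cases h : S.δ y = S.δ y'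
      · have h' : S.Compat (S.ext y b) y' := by
          rw [compat_iff, ← h, ← compat_iff]; exact S.compat_ext y b
        rw [if_pos h, if_pos h', star_prod, ← prod_mul_distrib]
        refine prod_congr rfl fun k _ => ?_
        rw [B_ext, bit_mul_add, sgn_add, star_mul, star_sgn, ← sqrt_two_inv_sq]
        have : star ((√2 : ℝ) : ℂ)⁻¹ = ((√2 : ℝ) : ℂ)⁻¹ := by
          rw [star_inv₀]; simp
        rw [this]
        ring
      · rw [if_neg h, if_neg, mul_zero]
        intro h'
        exact h (((S.compat_iff _ _).1 (S.compat_ext y b)).trans ((S.compat_iff _ _).1 h').symm)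
  rw [key, Matrix.one_apply]
  by_cases h : S.δ y = S.δ y'
  · simp only [if_pos h]
    -- The sum over `b` factors into one character sum per component, which tests whether `y` and
    -- `y'` agree at the marked vertex.
    have hp := (prod_univ_sum (fun _ : K => (univ : Finset (Fin 2)))
      (fun k b => (2⁻¹ : ℂ) * sgn (b * (y (S.root k) + y' (S.root k))))).symm
    rw [Fintype.piFinset_univ] at hp
    rw [hp]
    simp only [sum_sgn_mul, prod_ite_zero, prod_const_one]
    congr 1
    have aux : ∀ a b : Fin 2, a + b = 0 ↔ a = b := by decide
    simp only [aux, mem_univ, true_implies, eq_iff_iff]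
    exact ⟨fun hr => S.eq_of_δ_eq h hr, fun e k => by rw [e]⟩
  · simp only [if_neg h, sum_const_zero]
    rw [if_neg fun e => h (by rw [e])]

lemma unitary_mul_conjTranspose : S.unitary * S.unitary.conjTranspose = 1 :=
  (Matrix.mul_eq_one_comm_of_card_eq _ _ _ (by simp [S.card_eq])).1 S.conjTranspose_mul_unitary

/-! ### Images of the Pauli operators -/

/-- The sum of the vectors `r k` over the components at whose marked vertex `s` is `1`. -/
def rootSum (r : K → Q → Fin 2) (s : V → Fin 2) : Q → Fin 2 :=
  ∑ k, if s (S.root k) = 1 then r k else 0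

lemma dot_rootSum (r : K → Q → Fin 2) (s : V → Fin 2) (x : Q → Fin 2) :
    dot (S.rootSum r s) x = ∑ k, dot (r k) x * s (S.root k) := by
  rw [rootSum, sum_dot]
  refine sum_congr rfl fun k _ => ?_
  generalize s (S.root k) = a
  fin_cases a <;> simp [zero_dot]

/-- Translating by the compatible pair `(t, s)` preserves the support. As `t` does not change `B x`,
the amplitude changes only by the sign `(-1)^(B x k)` for each marked vertex where `s` is `1`, which
is a `Z` operator on the edges of the second type. -/
lemma unitary_mul_Xop_of_compat {t : Q → Fin 2} {s : V → Fin 2} (h : S.Compat t s)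
    (hB : S.B t = 0) : S.unitary * Xop s =
      Zop (S.rootSum (fun k => ind (S.sndEdges k)) s) * Xop t * S.unitary := by
  ext x y
  rw [mul_Xop_apply, Op.mul_assoc, Zop_mul_apply, Xop_mul_apply, dot_rootSum]
  simp only [unitary, Matrix.of_apply]
  have h1 : S.Compat (x + t) y ↔ S.Compat x (y + s) := by
    rw [← S.compat_add_iff h, bits_add_cancel]
  by_cases hc : S.Compat x (y + s)
  · rw [if_pos hc, if_pos (h1.2 hc), sgn_sum, ← prod_mul_distrib]
    refine prod_congr rfl fun k _ => ?_
    rw [B_add, hB, add_zero, Pi.add_apply, bit_mul_add, sgn_add, B]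
    ring
  · rw [if_neg hc, if_neg (fun h => hc (h1.1 h)), mul_zero]

lemma unitary_mul_Zop_of_compat {r : Q → Fin 2} {s : V → Fin 2}
    (h : ∀ x y, S.Compat x y → dot s y = dot r x) :
    S.unitary * Zop s = Zop r * S.unitary := by
  ext x y
  rw [mul_Zop_apply, Zop_mul_apply]
  simp only [unitary, Matrix.of_apply]
  by_cases hc : S.Compat x y
  · rw [h x y hc, mul_comm]
  · rw [if_neg hc, zero_mul, mul_zero]

/-- Pair the compatibility equation with `R`. The correction contributes the parity `B x` of every
component whose marked vertex has its first edge in `R`, whence the extra `Z` factor. -/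
lemma unitary_mul_Zop_of_not_snd {R : Set Q} (hR : ∀ q ∈ R, ¬ S.snd q) :
    S.unitary * Zop (ind (S.α ⁻¹' R)) =
      Zop (ind R + S.rootSum (fun k => ind (S.sndEdges k)) (ind (S.α ⁻¹' R))) * S.unitary := by
  classical
  refine S.unitary_mul_Zop_of_compat fun x y h => ?_
  have h1 := S.sum_δ_of_not_snd hR y
  rw [(S.compat_iff x y).1 h, dot_add, S.dot_corr_of_not_snd hR] at h1
  rw [ind_dot, add_dot, dot_rootSum]
  simp only [Set.mem_preimage]
  rw [← h1]
  congr 1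
  refine sum_congr rfl fun k _ => ?_
  by_cases hk : S.α (S.root k) ∈ R <;> simp [ind, hk, B]

lemma unitary_mul_Zop_of_snd {R : Set Q} (hR : ∀ q ∈ R, S.snd q) :
    S.unitary * Zop (ind (S.β ⁻¹' R)) =
      Zop (ind R + S.rootSum (fun k => ind (S.fstEdges k)) (ind (S.β ⁻¹' R))) * S.unitary := by
  classical
  refine S.unitary_mul_Zop_of_compat fun x y h => ?_
  have h1 := S.sum_δ_of_snd hR y
  rw [(S.compat_iff x y).1 h, dot_add, S.dot_corr_of_snd hR] at h1
  rw [ind_dot, add_dot, dot_rootSum]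
  simp only [Set.mem_preimage]
  rw [← h1]
  congr 1
  refine sum_congr rfl fun k _ => ?_
  by_cases hk : S.β (S.root k) ∈ R <;> simp [ind, hk, A]

/-- The vector `corr` of two equal arguments is compatible with `0`: adding it to `x` flips `B x k`
and keeps `y`. The Hadamard sign then changes by the bit of `y` at the marked vertex, so a `Z` there
becomes an `X` operator. -/
lemma unitary_mul_Zop_root (k : K) :
    S.unitary * Zop (ind ({S.root k} : Set V)) =
      Xop (S.corr (ind {k}) (ind {k})) * S.unitary := by
  classical
  have hc : S.Compat (S.corr (ind {k}) (ind {k})) 0 := by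
    rw [compat_iff, A_corr, B_corr, bits_add_self]
    funext q
    simp [δ]
  ext x y
  rw [mul_Zop_apply, Xop_mul_apply, ind_singleton_dot]
  simp only [unitary, Matrix.of_apply]
  have h1 := S.compat_add_iff (x := x) (y := y) hc
  rw [add_zero] at h1
  simp only [h1]
  by_cases h : S.Compat x y
  · rw [if_pos h, if_pos h, B_add, B_corr]
    have : sgn (y (S.root k)) = ∏ j, sgn (ind {k} j * y (S.root j)) := by
      rw [prod_eq_single k]
      · simp [ind]
      · intro j _ hj; simp [ind, hj]
      · simp
    rw [this, ← prod_mul_distrib]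
    refine prod_congr rfl fun j _ => ?_
    rw [Pi.add_apply, bit_add_mul, sgn_add, mul_assoc]
  · rw [if_neg h, if_neg h, zero_mul]

lemma ind_pair {Q : Type*} {p q : Q} (h : p ≠ q) : ind ({p, q} : Set Q) = ind {p} + ind {q} := by
  classical
  funext x
  by_cases h1 : x = p
  · subst h1; simp [ind, h]
  · by_cases h2 : x = q
    · subst h2; simp [ind, h1]
    · simp [ind, h1, h2]

theorem isClifford_unitary : IsClifford S.unitary := by
  classical
  refine isClifford_of_generators S.unitary_mul_conjTranspose S.conjTranspose_mul_unitary ?_ ?_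
  · intro s
    -- Among the vectors compatible with `s`, the one with free bits `0` is chosen, so that its
    -- parities `B` vanish.
    exact ⟨_, pauliGroup_mul (Zop_mem_pauliGroup _) (Xop_mem_pauliGroup _),
      S.unitary_mul_Xop_of_compat (S.compat_ext s 0) (S.B_ext s 0)⟩
  · have step : ∀ (v w : V) (r : Q → Fin 2), w ≠ v →
        S.unitary * Zop (ind ({v, w} : Set V)) = Zop r * S.unitary →
        (∃ N ∈ pauliGroup Q, S.unitary * Zop (ind ({v} : Set V)) = N * S.unitary) →
        ∃ N ∈ pauliGroup Q, S.unitary * Zop (ind ({w} : Set V)) = N * S.unitary := by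
      rintro v w r hw h ⟨N, hN, hv⟩
      refine ⟨Zop r * N, pauliGroup_mul (Zop_mem_pauliGroup _) hN, ?_⟩
      have : ind {w} = ind {v, w} + ind {v} := by
        rw [ind_pair hw.symm, add_comm (ind {v}), bits_add_cancel]
      rw [this, Zop_add, ← Op.mul_assoc, h, Op.mul_assoc, hv, Op.mul_assoc]
    refine S.induct _ ?_ ?_ ?_
    · exact fun k => ⟨_, Xop_mem_pauliGroup _, S.unitary_mul_Zop_root k⟩
    · intro v u hu hv
      obtain ⟨w, hw, hf⟩ := S.fiber_α v
      rcases (hf u).1 hu.symm with rfl | rfl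
      · exact hv
      · have h := S.unitary_mul_Zop_of_not_snd (R := {S.α v})
          (by rintro _ rfl; exact S.not_snd_α v)
        have hs : S.α ⁻¹' {S.α v} = {v, u} := by ext z; simp [hf]
        rw [hs] at h
        exact step v u _ hw h hv
    · intro v u hu hv
      obtain ⟨w, hw, hf⟩ := S.fiber_β v
      rcases (hf u).1 hu.symm with rfl | rfl
      · exact hv
      · have h := S.unitary_mul_Zop_of_snd (R := {S.β v})
          (by rintro _ rfl; exact S.snd_β v)
        have hs : S.β ⁻¹' {S.β v} = {v, u} := by ext z; simp [hf]
        rw [hs] at h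
        exact step v u _ hw h hv

end CycleSystem

namespace CycleSystem

variable {V Q K : Type*}

/-! ### Restriction to one component -/

/-- One component of a system of cycles. -/
def restrict (S : CycleSystem V Q K) (k : K) {pV : V → Prop} {pQ : Q → Prop}
    (hV : ∀ v, pV v ↔ S.comp (S.α v) = k) (hQ : ∀ q, pQ q ↔ S.comp q = k) :
    CycleSystem {v // pV v} {q // pQ q} Unit where
  α v := ⟨S.α v.1, (hQ _).2 ((hV _).1 v.2)⟩
  β v := ⟨S.β v.1, (hQ _).2 ((S.comp_β _).trans ((hV _).1 v.2))⟩
  snd q := S.snd q.1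
  comp _ := ()
  root _ := ⟨S.root k, (hV _).2 (S.comp_root k)⟩
  not_snd_α v := S.not_snd_α v.1
  snd_β v := S.snd_β v.1
  exists_α := by
    rintro ⟨q, hq⟩ h
    obtain ⟨v, rfl⟩ := S.exists_α q h
    exact ⟨⟨v, (hV v).2 ((hQ _).1 hq)⟩, rfl⟩
  exists_β := by
    rintro ⟨q, hq⟩ h
    obtain ⟨v, rfl⟩ := S.exists_β q h
    exact ⟨⟨v, (hV v).2 ((S.comp_β v).symm.trans ((hQ _).1 hq))⟩, rfl⟩
  comp_β _ := rfl
  comp_root _ := rfl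
  fiber_α := by
    rintro ⟨v, hv⟩
    obtain ⟨w, hw, hf⟩ := S.fiber_α v
    have hw' : pV w := by
      rw [hV, (hf w).2 (Or.inr rfl), ← hV]; exact hv
    refine ⟨⟨w, hw'⟩, fun h => hw (congrArg Subtype.val h), fun u => ?_⟩
    simp only [Subtype.ext_iff]
    exact hf u.1
  fiber_β := by
    rintro ⟨v, hv⟩
    obtain ⟨w, hw, hf⟩ := S.fiber_β v
    have hw' : pV w := by
      rw [hV, ← S.comp_β, (hf w).2 (Or.inr rfl), S.comp_β, ← hV]; exact hv
    refine ⟨⟨w, hw'⟩, fun h => hw (congrArg Subtype.val h), fun u => ?_⟩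
    simp only [Subtype.ext_iff]
    exact hf u.1
  induct := by
    rintro P hr hα hβ ⟨v, hv⟩
    -- Vertices outside the component satisfy the strengthened predicate vacuously; edges never
    -- leave the component.
    refine S.induct (fun v => ∀ h : pV v, P ⟨v, h⟩) ?_ ?_ ?_ v hv
    · intro j hj
      have hjk : j = k := (S.comp_root j).symm.trans ((hV _).1 hj)
      subst hjk
      exact hr ()
    · intro v w h hP hw
      have hv : pV v := by rw [hV, h, ← hV]; exact hw
      exact hα ⟨v, hv⟩ ⟨w, hw⟩ (Subtype.ext h) (hP hv)
    · intro v w h hP hw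
      have hv : pV v := by rw [hV, ← S.comp_β, h, S.comp_β, ← hV]; exact hw
      exact hβ ⟨v, hv⟩ ⟨w, hw⟩ (Subtype.ext h) (hP hv)

lemma sum_eq_sum_subtype {ι M : Type*} [AddCommMonoid M] [Fintype ι] {p : ι → Prop}
    [Fintype {i // p i}] {f : ι → M} {g : {i // p i} → M} (hfg : ∀ i, g i = f i.1)
    (hf : ∀ i, ¬ p i → f i = 0) :
    ∑ i, g i = ∑ i, f i := by
  refine sum_of_injOn Subtype.val (Subtype.val_injective.injOn) (by simp) ?_ fun i _ => hfg i
  intro i _ hi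
  exact hf i fun h => hi ⟨⟨i, h⟩, by simp, rfl⟩

variable [Fintype V] [DecidableEq V] [Fintype Q] [DecidableEq Q] [Fintype K]
  [DecidableEq K] (S : CycleSystem V Q K) (k : K) {pV : V → Prop} {pQ : Q → Prop}
  (hV : ∀ v, pV v ↔ S.comp (S.α v) = k) (hQ : ∀ q, pQ q ↔ S.comp q = k)
  [Fintype {v // pV v}] [Fintype {q // pQ q}]

lemma A_restrict (x : Q → Fin 2) :
    (S.restrict k hV hQ).A (fun q => x q.1) = fun _ => S.A x k := by
  classical
  funext _
  refine sum_eq_sum_subtype (fun q => ?_) fun q hq => ?_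
  · have h := (hQ _).1 q.2
    exact congrArg (· * x q.1) (if_congr (by simp [fstEdges, restrict, h]) rfl rfl)
  · simp [ind, fstEdges, (hQ q).not.1 hq]

lemma B_restrict (x : Q → Fin 2) :
    (S.restrict k hV hQ).B (fun q => x q.1) = fun _ => S.B x k := by
  classical
  funext _
  refine sum_eq_sum_subtype (fun q => ?_) fun q hq => ?_
  · have h := (hQ _).1 q.2
    exact congrArg (· * x q.1) (if_congr (by simp [sndEdges, restrict, h]) rfl rfl)
  · simp [ind, sndEdges, (hQ q).not.1 hq]

lemma δ_restrict (y : V → Fin 2) (q : {q // pQ q}) :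
    (S.restrict k hV hQ).δ (fun v => y v.1) q = S.δ y q.1 := by
  classical
  refine congrArg₂ (· + ·) ?_ ?_
  · refine sum_eq_sum_subtype (fun v => ?_) fun v hv => ?_
    · simp [restrict, Subtype.ext_iff]
    · rw [if_neg]
      rintro h
      exact hv ((hV v).2 (h ▸ (hQ _).1 q.2))
  · refine sum_eq_sum_subtype (fun v => ?_) fun v hv => ?_
    · simp [restrict, Subtype.ext_iff]
    · rw [if_neg]
      rintro h
      exact hv ((hV v).2 ((S.comp_β v).symm.trans (h ▸ (hQ _).1 q.2)))

lemma compat_restrict (x : Q → Fin 2) (y : V → Fin 2) :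
    (S.restrict k hV hQ).Compat (fun q => x q.1) (fun v => y v.1) ↔
      ∀ q, pQ q → S.δ y q = x q + S.corr (S.A x) (S.B x) q := by
  simp only [Compat, Subtype.forall]
  refine forall₂_congr fun q hq => ?_
  rw [δ_restrict, A_restrict, B_restrict]
  have : (S.restrict k hV hQ).corr (fun _ => S.A x k) (fun _ => S.B x k) ⟨q, hq⟩
      = S.corr (S.A x) (S.B x) q := by
    simp [corr, restrict, Subtype.ext_iff, (hQ q).1 hq]
  rw [this]

/-- The unitary of a system of cycles is the tensor product of those of its components. -/
theorem unitary_eq_prod {pV : K → V → Prop} {pQ : K → Q → Prop}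
    (hV : ∀ k v, pV k v ↔ S.comp (S.α v) = k) (hQ : ∀ k q, pQ k q ↔ S.comp q = k)
    [∀ k, Fintype {v // pV k v}] [∀ k, Fintype {q // pQ k q}] (x : Q → Fin 2) (y : V → Fin 2) :
    S.unitary x y =
      ∏ k, (S.restrict k (hV k) (hQ k)).unitary (fun q => x q.1) (fun v => y v.1) := by
  classical
  simp only [unitary, Matrix.of_apply]
  simp only [compat_restrict, B_restrict]
  by_cases h : S.Compat x y
  · rw [if_pos h]
    refine prod_congr rfl fun k _ => ?_
    rw [if_pos fun q _ => h q]
    simp [restrict]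
  · rw [if_neg h]
    obtain ⟨q, hq⟩ := not_forall.1 h
    -- An edge where compatibility fails makes the factor of its own component vanish.
    refine (prod_eq_zero (mem_univ (S.comp q)) ?_).symm
    exact if_neg fun h' => hq (h' q ((hQ _ q).2 rfl))

/-- If `δ s` vanishes on one type, its parity there is zero. Both parities of `δ s` equal `par s`,
so both vanish, no correction occurs, and `δ s` itself is compatible with `s`. -/
lemma unitary_mul_Xop_of_δ {t : Q → Fin 2} {s : V → Fin 2} (h : S.δ s = t)
    (ht : (∀ q, ¬ S.snd q → t q = 0) ∨ ∀ q, S.snd q → t q = 0) : S.unitary * Xop s =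
      Zop (S.rootSum (fun k => ind (S.sndEdges k)) s) * Xop t * S.unitary := by
  classical
  have hA : S.A t = S.par s := by rw [← h, A_δ]
  have hB : S.B t = S.par s := by rw [← h, B_δ]
  have h0 : S.par s = 0 := by
    rcases ht with ht | ht
    · rw [← hA]
      funext k
      rw [A, ind_dot]
      refine sum_eq_zero fun q _ => ?_
      split_ifs with hq
      exacts [ht q hq.1, rfl]
    · rw [← hB]
      funext k
      rw [B, ind_dot]
      refine sum_eq_zero fun q _ => ?_
      split_ifs with hq
      exacts [ht q hq.1, rfl]
  refine S.unitary_mul_Xop_of_compat ?_ (hB.trans h0)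
  rw [compat_iff, h, hA, hB, h0]
  funext q
  simp [corr]

end CycleSystem

/-! ### Conjugation and tensor products as homomorphisms -/

section Homs

variable {Q R : Type*} [Fintype Q] [DecidableEq Q] [Fintype R] [DecidableEq R]

/-- Conjugation by a unitary as a homomorphism of groups of invertible operators. -/
def conjHom (U : Op R Q) (h₁ : U * U.conjTranspose = 1) (h₂ : U.conjTranspose * U = 1) :
    (Op Q Q)ˣ →* (Op R R)ˣ :=
  Units.map
    { toFun := fun M => U * M * U.conjTranspose
      map_one' := by rw [Matrix.mul_one, h₁]
      map_mul' := fun M N => by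
        rw [Op.mul_assoc (U * M), Op.mul_assoc U N, ← Op.mul_assoc U.conjTranspose, h₂, Op.one_mul]
        simp only [Op.mul_assoc] }

lemma coe_conjHom (U : Op R Q) (h₁ : U * U.conjTranspose = 1) (h₂ : U.conjTranspose * U = 1)
    (g : (Op Q Q)ˣ) : (conjHom U h₁ h₂ g : Op R R) = U * (g : Op Q Q) * U.conjTranspose := rfl

lemma conjHom_eq {U : Op R Q} {h₁ : U * U.conjTranspose = 1} {h₂ : U.conjTranspose * U = 1}
    {g : (Op Q Q)ˣ} {g' : (Op R R)ˣ} (h : U * (g : Op Q Q) = (g' : Op R R) * U) :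
    conjHom U h₁ h₂ g = g' := by
  refine Units.ext ?_
  rw [coe_conjHom, h, Op.mul_assoc, h₁, Op.mul_one]

lemma tensor_mul (M M' : Op Q Q) (N N' : Op R R) :
    tensor (M * M') (N * N') = tensor M N * tensor M' N' := by
  ext x y
  simp only [tensor, Matrix.of_apply, Matrix.mul_apply]
  rw [sum_mul_sum, ← Fintype.sum_prod_type']
  refine (Fintype.sum_equiv (Equiv.sumArrowEquivProdArrow Q R (Fin 2)) _ _ fun z => ?_).symm
  simp only [Equiv.sumArrowEquivProdArrow, Equiv.coe_fn_mk, Function.comp_def]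
  ring

lemma tensor_one : tensor (1 : Op Q Q) (1 : Op R R) = 1 := by
  ext x y
  simp only [tensor, Matrix.of_apply, Matrix.one_apply]
  rw [ite_zero_mul_ite_zero, mul_one]
  refine if_congr ?_ rfl rfl
  simp only [funext_iff, Sum.forall]

/-- The tensor product as a homomorphism of groups of invertible operators. -/
def tensorHom : (Op Q Q)ˣ × (Op R R)ˣ →* (Op (Q ⊕ R) (Q ⊕ R))ˣ :=
  (Units.map
    { toFun := fun p : Op Q Q × Op R R => tensor p.1 p.2
      map_one' := tensor_one
      map_mul' := fun _ _ => tensor_mul _ _ _ _ }).comp MulEquiv.prodUnits.symm.toMonoidHom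

lemma tensorGroup_eq (G : Subgroup (Op Q Q)ˣ) (H : Subgroup (Op R R)ˣ) :
    tensorGroup G H = ops ((G.prod H).map tensorHom) := by
  ext T
  constructor
  · rintro ⟨_, ⟨g, hg, rfl⟩, _, ⟨h, hh, rfl⟩, rfl⟩
    exact ⟨tensorHom (g, h), ⟨(g, h), ⟨hg, hh⟩, rfl⟩, rfl⟩
  · rintro ⟨_, ⟨⟨g, h⟩, ⟨hg, hh⟩, rfl⟩, rfl⟩
    exact ⟨_, ⟨g, hg, rfl⟩, _, ⟨h, hh, rfl⟩, rfl⟩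

lemma conj_ops_eq (U : Op R Q) (h₁ : U * U.conjTranspose = 1) (h₂ : U.conjTranspose * U = 1)
    (G : Subgroup (Op Q Q)ˣ) :
    {T | ∃ M ∈ ops G, T = U * M * U.conjTranspose} = ops (G.map (conjHom U h₁ h₂)) := by
  ext T
  constructor
  · rintro ⟨_, ⟨g, hg, rfl⟩, rfl⟩
    exact ⟨_, ⟨g, hg, rfl⟩, rfl⟩
  · rintro ⟨_, ⟨g, hg, rfl⟩, rfl⟩
    exact ⟨_, ⟨g, hg, rfl⟩, rfl⟩

lemma sgn_dot_sum (r x : Q ⊕ R → Fin 2) :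
    sgn (dot r x) = sgn (dot (fun q => r (Sum.inl q)) fun q => x (Sum.inl q)) *
      sgn (dot (fun q => r (Sum.inr q)) fun q => x (Sum.inr q)) := by
  rw [← sgn_add]
  simp [dot]

lemma tensor_Xop (s : Q → Fin 2) (t : R → Fin 2) :
    tensor (Xop s) (Xop t) = Xop (Sum.elim s t) := by
  ext x y
  simp only [tensor, Xop, Matrix.of_apply]
  rw [ite_zero_mul_ite_zero, mul_one]
  refine if_congr ?_ rfl rfl
  simp [funext_iff]

lemma tensor_Zop (s : Q → Fin 2) (t : R → Fin 2) :
    tensor (Zop s) (Zop t) = Zop (Sum.elim s t) := by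
  ext x y
  simp only [tensor, Zop, Matrix.of_apply, Matrix.diagonal_apply]
  rw [ite_zero_mul_ite_zero, sgn_dot_sum]
  refine if_congr ?_ rfl rfl
  simp [funext_iff]

/-! ### Pauli operators as invertible operators -/

/-- `Xop` as an invertible operator. -/
def XUnit (s : Q → Fin 2) : (Op Q Q)ˣ :=
  ⟨Xop s, Xop s, by rw [← Xop_add, bits_add_self, Xop_zero],
    by rw [← Xop_add, bits_add_self, Xop_zero]⟩

/-- `Zop` as an invertible operator. -/
def ZUnit (s : Q → Fin 2) : (Op Q Q)ˣ :=
  ⟨Zop s, Zop s, by rw [← Zop_add, bits_add_self, Zop_zero],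
    by rw [← Zop_add, bits_add_self, Zop_zero]⟩

lemma XOn_eq (S : Set Q) : XOn S = XUnit (ind S) := Units.ext (onSet_σX S)

lemma ZOn_eq (S : Set Q) : ZOn S = ZUnit (ind S) := Units.ext (onSet_σZ S)

lemma ZUnit_add (s t : Q → Fin 2) : ZUnit (s + t) = ZUnit s * ZUnit t := Units.ext (Zop_add s t)

lemma ZUnit_zero : ZUnit (0 : Q → Fin 2) = 1 := Units.ext Zop_zero

lemma XUnit_zero : XUnit (0 : Q → Fin 2) = 1 := Units.ext Xop_zero

lemma tensorHom_XUnit (s : Q → Fin 2) (t : R → Fin 2) :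
    tensorHom (XUnit s, XUnit t) = XUnit (Sum.elim s t) := Units.ext (tensor_Xop s t)

lemma tensorHom_ZUnit (s : Q → Fin 2) (t : R → Fin 2) :
    tensorHom (ZUnit s, ZUnit t) = ZUnit (Sum.elim s t) := Units.ext (tensor_Zop s t)

lemma ZUnit_sum_mem {ι : Type*} (H : Subgroup (Op Q Q)ˣ) (s : Finset ι) (r : ι → Q → Fin 2)
    (h : ∀ i ∈ s, ZUnit (r i) ∈ H) : ZUnit (∑ i ∈ s, r i) ∈ H := by
  classical
  induction s using Finset.induction_on with
  | empty => rw [sum_empty, ZUnit_zero]; exact H.one_mem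
  | insert a s ha ih =>
    rw [sum_insert ha, ZUnit_add]
    exact H.mul_mem (h a (mem_insert_self a s)) (ih fun i hi => h i (mem_insert_of_mem hi))

end Homs

namespace Lattice

variable {V E F Φ : Type*} {L : Lattice V E F Φ} {col : F → Color}

/-! ### Flags of a colored 3-valent lattice -/

/-- By the braid relation, the involutions `τ1` and `τ2` generate at most six flags from a given
one. -/
lemma flags_of_vert (h3 : L.ThreeValent) {φ ψ : Φ} (h : L.vert ψ = L.vert φ) :
    ψ = φ ∨ ψ = L.τ1 φ ∨ ψ = L.τ2 φ ∨ ψ = L.τ1 (L.τ2 φ) ∨ ψ = L.τ2 (L.τ1 φ) ∨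
      ψ = L.τ1 (L.τ2 (L.τ1 φ)) := by
  have h' := (L.vert_eq_iff φ ψ).1 h.symm
  clear h
  have e1 := L.τ1_τ1
  have e2 := L.τ2_τ2
  have hb := braid h3
  unfold SameOrbit at h'
  induction h' with
  | refl => exact Or.inl rfl
  | tail _ hstep ih =>
    rcases hstep with rfl | rfl <;> rcases ih with rfl | rfl | rfl | rfl | rfl | rfl <;> grind

lemma flags_of_edge {φ ψ : Φ} (h : L.edge ψ = L.edge φ) :
    ψ = φ ∨ ψ = L.τ0 φ ∨ ψ = L.τ2 φ ∨ ψ = L.τ0 (L.τ2 φ) := by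
  have h' := (L.edge_eq_iff φ ψ).1 h.symm
  clear h
  have e1 := L.τ0_τ0
  have e2 := L.τ2_τ2
  have hb := L.τ0_τ2
  unfold SameOrbit at h'
  induction h' with
  | refl => exact Or.inl rfl
  | tail _ hstep ih =>
    rcases hstep with rfl | rfl <;> rcases ih with rfl | rfl | rfl | rfl <;> grind

/-- The criterion is invariant under `τ0`, which exchanges the ends, and under `τ2`, which keeps
them. It can therefore be tested on any flag of the edge. -/
lemma mem_coboundary_iff (L : Lattice V E F Φ) (φ : Φ) (v : V) :
    L.edge φ ∈ L.coboundary v ↔ ¬ (L.vert φ = v ↔ L.vert (L.τ0 φ) = v) := by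
  constructor
  · rintro ⟨ψ, he, h1, h2⟩
    rcases flags_of_edge he with rfl | rfl | rfl | rfl
    · tauto
    · rw [L.τ0_τ0] at h2; tauto
    · rw [L.τ0_τ2, L.vert_τ2] at h2; rw [L.vert_τ2] at h1; tauto
    · rw [L.τ0_τ0, L.vert_τ2] at h2; rw [L.τ0_τ2, L.vert_τ2] at h1; tauto
  · intro h
    by_cases h1 : L.vert φ = v
    · exact ⟨φ, rfl, h1, by tauto⟩
    · exact ⟨L.τ0 φ, L.edge_τ0 φ, by tauto, by rwa [L.τ0_τ0]⟩

lemma mem_boundary_iff (L : Lattice V E F Φ) (φ : Φ) (f : F) :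
    L.edge φ ∈ L.boundary f ↔ ¬ (L.face φ = f ↔ L.face (L.τ2 φ) = f) := by
  constructor
  · rintro ⟨ψ, he, h1, h2⟩
    rcases flags_of_edge he with rfl | rfl | rfl | rfl
    · tauto
    · rw [← L.τ0_τ2, L.face_τ0] at h2; rw [L.face_τ0] at h1; tauto
    · rw [L.τ2_τ2] at h2; tauto
    · rw [L.τ0_τ2, L.τ2_τ2, L.face_τ0] at h2; rw [L.face_τ0] at h1; tauto
  · intro h
    by_cases h1 : L.face φ = f
    · exact ⟨φ, rfl, h1, by tauto⟩
    · exact ⟨L.τ2 φ, L.edge_τ2 φ, by tauto, by rwa [L.τ2_τ2]⟩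

/-- The two other faces around the vertex have colors different from that of `φ`, so the color
singles out one corner, which has two flags. -/
lemma flags_of_vert_of_col (h3 : L.ThreeValent) (hc : L.ProperColoring col) {φ ψ : Φ}
    (h : L.vert ψ = L.vert φ) (hcol : col (L.face ψ) = col (L.face φ)) : ψ = φ ∨ ψ = L.τ1 φ := by
  have h2 := hc φ
  have h1 := hc (L.τ1 φ)
  rw [L.face_τ1] at h1
  rcases flags_of_vert h3 h with rfl | rfl | rfl | rfl | rfl | rfl
  · exact Or.inl rfl
  · exact Or.inr rfl
  · exact absurd hcol.symm h2
  · rw [L.face_τ1] at hcol; exact absurd hcol.symm h2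
  · exact absurd hcol.symm h1
  · rw [L.face_τ1] at hcol; exact absurd hcol.symm h1

lemma flags_of_edge_of_col (hc : L.ProperColoring col) {φ ψ : Φ}
    (h : L.edge ψ = L.edge φ) (hcol : col (L.face ψ) = col (L.face φ)) : ψ = φ ∨ ψ = L.τ0 φ := by
  have h2 := hc φ
  rcases flags_of_edge h with rfl | rfl | rfl | rfl
  · exact Or.inl rfl
  · exact Or.inr rfl
  · exact absurd hcol.symm h2
  · rw [L.face_τ0] at hcol; exact absurd hcol.symm h2

lemma face_eq_of_vert_of_col (h3 : L.ThreeValent) (hc : L.ProperColoring col) {φ ψ : Φ}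
    (h : L.vert ψ = L.vert φ) (hcol : col (L.face ψ) = col (L.face φ)) : L.face ψ = L.face φ := by
  rcases flags_of_vert_of_col h3 hc h hcol with rfl | rfl
  · rfl
  · rw [L.face_τ1]

lemma mem_faceVerts_iff (h3 : L.ThreeValent) (hc : L.ProperColoring col) {φ : Φ} {f : F}
    (hcol : col (L.face φ) = col f) : L.vert φ ∈ L.faceVerts f ↔ L.face φ = f := by
  constructor
  · rintro ⟨ψ, hv, rfl⟩
    exact (face_eq_of_vert_of_col h3 hc hv hcol.symm).symm
  · exact fun h => ⟨φ, rfl, h⟩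

lemma mem_faceEdges_iff (hc : L.ProperColoring col) {φ : Φ} {f : F}
    (hcol : col (L.face φ) = col f) : L.edge φ ∈ L.faceEdges f ↔ L.face φ = f := by
  constructor
  · rintro ⟨ψ, hv, rfl⟩
    rcases flags_of_edge_of_col hc hv hcol.symm with rfl | rfl
    · rfl
    · rw [L.face_τ0]
  · exact fun h => ⟨φ, rfl, h⟩

lemma exists_col_eq_of_avoids (hc : L.ProperColoring col) {d : Color} (hd : d ≠ Color.C) {e : E}
    (he : L.Avoids col d e) : ∃ φ, L.edge φ = e ∧ col (L.face φ) = Color.C := by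
  obtain ⟨φ, rfl⟩ := L.edge_surj e
  have h := (avoids_iff d φ).1 he
  have h' := hc φ
  by_cases h1 : col (L.face φ) = Color.C
  · exact ⟨φ, rfl, h1⟩
  · refine ⟨L.τ2 φ, L.edge_τ2 φ, ?_⟩
    generalize col (L.face φ) = x at *
    generalize col (L.face (L.τ2 φ)) = y at *
    cases x <;> cases y <;> cases d <;> simp_all

/-- For a flag on a face of color `C`, the edge avoids exactly one of the colors `A`, `B`. -/
lemma avoids_iff_not_avoids (hc : L.ProperColoring col) {d d' : Color} (hd : d ≠ Color.C)
    (hd' : d' ≠ Color.C) (hdd : d ≠ d') {φ : Φ} (hφ : col (L.face φ) = Color.C) :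
    L.Avoids col d (L.edge φ) ↔ ¬ L.Avoids col d' (L.edge φ) := by
  have h' := hc φ
  rw [avoids_iff, avoids_iff, hφ]
  rw [hφ] at h'
  generalize col (L.face (L.τ2 φ)) = y at *
  cases y <;> cases d <;> cases d' <;> simp_all

/-- All three colors occur around `v`, and exactly one of the two edges in the corner of the `C`
face avoids `d`. -/
lemma exists_flag (h3 : L.ThreeValent) (hc : L.ProperColoring col) {d : Color} (hd : d ≠ Color.C)
    (v : V) : ∃ φ, L.vert φ = v ∧ col (L.face φ) = Color.C ∧ L.Avoids col d (L.edge φ) := by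
  have hC : ∃ φ, L.vert φ = v ∧ col (L.face φ) = Color.C := by
    obtain ⟨φ, rfl⟩ := L.vert_surj v
    have h1 := hc φ
    have h2 := hc (L.τ1 φ)
    rw [L.face_τ1] at h2
    have h3 := third_ne h3 hc φ
    have key : col (L.face φ) = Color.C ∨ col (L.face (L.τ2 φ)) = Color.C ∨
        col (L.face (L.τ2 (L.τ1 φ))) = Color.C := by
      generalize col (L.face φ) = x at *
      generalize col (L.face (L.τ2 φ)) = y at *
      generalize col (L.face (L.τ2 (L.τ1 φ))) = z at *
      cases x <;> cases y <;> cases z <;> simp_all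
    rcases key with h | h | h
    · exact ⟨_, rfl, h⟩
    · exact ⟨_, L.vert_τ2 φ, h⟩
    · exact ⟨_, by rw [L.vert_τ2, L.vert_τ1], h⟩
  obtain ⟨φ, hv, hφ⟩ := hC
  by_cases h : L.Avoids col d (L.edge φ)
  · exact ⟨φ, hv, hφ, h⟩
  · refine ⟨L.τ1 φ, by rw [L.vert_τ1, hv], by rw [L.face_τ1, hφ], ?_⟩
    exact (avoids_τ1_iff h3 hc d φ (by rw [hφ]; exact hd.symm)).2 h

lemma color_eq_of_ne {c d x y : Color} (hcd : d ≠ c) (hxc : x ≠ c) (hxd : x ≠ d) (hyc : y ≠ c)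
    (hyd : y ≠ d) : x = y := by
  cases c <;> cases d <;> cases x <;> cases y <;> simp_all

/-! ### The distinguished flag of a vertex on its face of color `C`. -/

section Flag

variable (h3 : L.ThreeValent) (hc : L.ProperColoring col) {d : Color} (hd : d ≠ Color.C)

/-- The flag at the vertex `v` on its face of color `C` and on its edge avoiding the color `d`. -/
def flag (v : V) : Φ := (exists_flag h3 hc hd v).choose

lemma vert_flag (v : V) : L.vert (flag h3 hc hd v) = v := (exists_flag h3 hc hd v).choose_spec.1

lemma col_flag (v : V) : col (L.face (flag h3 hc hd v)) = Color.C :=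
  (exists_flag h3 hc hd v).choose_spec.2.1

lemma avoids_flag (v : V) : L.Avoids col d (L.edge (flag h3 hc hd v)) :=
  (exists_flag h3 hc hd v).choose_spec.2.2

lemma flag_vert {φ : Φ} (hφ : col (L.face φ) = Color.C) (ha : L.Avoids col d (L.edge φ)) :
    flag h3 hc hd (L.vert φ) = φ := by
  rcases flags_of_vert_of_col h3 hc (vert_flag h3 hc hd (L.vert φ))
    ((col_flag h3 hc hd _).trans hφ.symm) with h | h
  · exact h
  · have h' := avoids_flag h3 hc hd (L.vert φ)
    rw [h, avoids_τ1_iff h3 hc d φ (by rw [hφ]; exact hd.symm)] at h'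
    exact absurd ha h'

lemma face_flag_vert {φ : Φ} (hφ : col (L.face φ) = Color.C) :
    L.face (flag h3 hc hd (L.vert φ)) = L.face φ :=
  face_eq_of_vert_of_col h3 hc (vert_flag h3 hc hd _) ((col_flag h3 hc hd _).trans hφ.symm)

/-- The other end of the edge of `flag v`. -/
def opp (v : V) : V := L.vert (L.τ0 (flag h3 hc hd v))

lemma flag_opp (v : V) : flag h3 hc hd (opp h3 hc hd v) = L.τ0 (flag h3 hc hd v) :=
  flag_vert h3 hc hd (by rw [L.face_τ0]; exact col_flag h3 hc hd v) (by rw [L.edge_τ0]; exact avoids_flag h3 hc hd v)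

lemma opp_ne (v : V) : opp h3 hc hd v ≠ v := by
  intro h
  have := flag_opp h3 hc hd v
  rw [h] at this
  exact L.τ0_ne _ this.symm

lemma edge_flag_eq_iff (u v : V) : L.edge (flag h3 hc hd u) = L.edge (flag h3 hc hd v) ↔
    u = v ∨ u = opp h3 hc hd v := by
  constructor
  · intro h
    rcases flags_of_edge_of_col hc h ((col_flag h3 hc hd u).trans (col_flag h3 hc hd v).symm)
      with h | h
    · left
      rw [← vert_flag h3 hc hd u, h, vert_flag]
    · right
      rw [← vert_flag h3 hc hd u, h, opp]
  · rintro (rfl | rfl)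
    · rfl
    · rw [flag_opp, L.edge_τ0]

lemma exists_edge_flag {e : E} (he : L.Avoids col d e) : ∃ v, L.edge (flag h3 hc hd v) = e := by
  obtain ⟨φ, rfl, hφ⟩ := exists_col_eq_of_avoids hc hd he
  exact ⟨L.vert φ, by rw [flag_vert h3 hc hd hφ he]⟩

/-- The face of color `C` along an edge avoiding the color `d`. -/
def cFace (e : {e : E // L.Avoids col d e}) : {f : F // col f = Color.C} :=
  ⟨L.face (exists_col_eq_of_avoids hc hd e.2).choose,
    (exists_col_eq_of_avoids hc hd e.2).choose_spec.2⟩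

lemma cFace_eq {φ : Φ} (hφ : col (L.face φ) = Color.C) (ha : L.Avoids col d (L.edge φ)) :
    cFace hc hd ⟨L.edge φ, ha⟩ = ⟨L.face φ, hφ⟩ := by
  obtain ⟨h1, h2⟩ := (exists_col_eq_of_avoids hc hd ha).choose_spec
  refine Subtype.ext ?_
  change L.face (exists_col_eq_of_avoids hc hd ha).choose = _
  rcases flags_of_edge_of_col hc h1 (h2.trans hφ.symm) with h | h
  · rw [h]
  · rw [h, L.face_τ0]

/-! ### Incidences in the shrunk lattices, read off at the vertices of the original one. -/

/-- The edge avoiding the color `d` at the vertex `v`. -/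
def edgeAt (v : V) : {e : E // L.Avoids col d e} :=
  ⟨L.edge (flag h3 hc hd v), avoids_flag h3 hc hd v⟩

lemma cFace_edgeAt (v : V) :
    cFace hc hd (edgeAt h3 hc hd v) = ⟨L.face (flag h3 hc hd v), col_flag h3 hc hd v⟩ :=
  cFace_eq hc hd (col_flag h3 hc hd v) (avoids_flag h3 hc hd v)

lemma edgeAt_eq_iff (u v : V) : edgeAt h3 hc hd u = edgeAt h3 hc hd v ↔
    u = v ∨ u = opp h3 hc hd v := by
  rw [← edge_flag_eq_iff h3 hc hd]
  exact Subtype.ext_iff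

lemma exists_edgeAt (e : {e : E // L.Avoids col d e}) : ∃ v, edgeAt h3 hc hd v = e := by
  obtain ⟨v, hv⟩ := exists_edge_flag h3 hc hd e.2
  exact ⟨v, Subtype.ext hv⟩

lemma face_flag_eq {d' : Color} (hd' : d' ≠ Color.C) (v : V) :
    L.face (flag h3 hc hd' v) = L.face (flag h3 hc hd v) :=
  face_eq_of_vert_of_col h3 hc (by rw [vert_flag, vert_flag])
    ((col_flag h3 hc hd' v).trans (col_flag h3 hc hd v).symm)

/-- The two sides of this edge are the faces at `v` of the two colors other than `d`, so a face of
such a color contains `v` exactly when it is one of the sides. The sides have different colors,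
hence no cancellation modulo 2. -/
lemma mem_faceVerts_iff_edgeAt_mem_boundary {f : F} (hf : col f ≠ d) (v : V) :
    v ∈ L.faceVerts f ↔ edgeAt h3 hc hd v ∈ (L.shrink col h3 hc d).boundary ⟨f, hf⟩ := by
  have hb := (L.shrink col h3 hc d).mem_boundary_iff
    ⟨flag h3 hc hd v, avoids_flag h3 hc hd v⟩ ⟨f, hf⟩
  have hφ := col_flag h3 hc hd v
  have h2 := hc (flag h3 hc hd v)
  have hav := (avoids_iff d _).1 (avoids_flag h3 hc hd v)
  have hv := vert_flag h3 hc hd v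
  change edgeAt h3 hc hd v ∈ (L.shrink col h3 hc d).boundary ⟨f, hf⟩ ↔ _ at hb
  rw [hb]
  simp only [shrink, Subtype.mk.injEq]
  by_cases hfC : col f = Color.C
  · have h1 := mem_faceVerts_iff h3 hc (φ := flag h3 hc hd v) (f := f) (by rw [hφ, hfC])
    have hne : L.face (L.τ2 (flag h3 hc hd v)) ≠ f := by
      rintro rfl
      exact h2 (by rw [hφ, hfC])
    rw [hv] at h1
    tauto
  · have hcol : col (L.face (L.τ2 (flag h3 hc hd v))) = col f := by
      rw [hφ] at h2
      exact color_eq_of_ne hd h2.symm hav.2 hfC hf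
    have h1 := mem_faceVerts_iff h3 hc hcol
    have hne : L.face (flag h3 hc hd v) ≠ f := by
      rintro rfl
      exact hfC hφ
    rw [L.vert_τ2, hv] at h1
    tauto

/-- Each end of the edge lies on a single face of color `d`, and this face is the vertex of the
shrunk lattice at that end. -/
lemma edgeAt_mem_coboundary_iff {f : F} (hf : col f = d) (v : V) :
    edgeAt h3 hc hd v ∈ (L.shrink col h3 hc d).coboundary ⟨f, hf⟩ ↔
      ¬ (v ∈ L.faceVerts f ↔ opp h3 hc hd v ∈ L.faceVerts f) := by
  have hb := (L.shrink col h3 hc d).mem_coboundary_iff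
    ⟨flag h3 hc hd v, avoids_flag h3 hc hd v⟩ ⟨f, hf⟩
  have key : ∀ u, u ∈ L.faceVerts f ↔ L.face (L.τ2 (L.τ1 (flag h3 hc hd u))) = f := by
    intro u
    have h1 := (avoids_iff_third h3 hc d _).1 (avoids_flag h3 hc hd u)
    have h2 := mem_faceVerts_iff h3 hc (h1.trans hf.symm)
    rwa [L.vert_τ2, L.vert_τ1, vert_flag] at h2
  refine hb.trans ?_
  rw [key, key, flag_opp]
  simp only [shrink, Subtype.mk.injEq]

lemma mem_boundary_iff_cFace {f : F} (hf : col f = Color.C) (e : {e : E // L.Avoids col d e}) :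
    e ∈ (L.shrink col h3 hc d).boundary ⟨f, by rw [hf]; exact hd.symm⟩ ↔
      cFace hc hd e = ⟨f, hf⟩ := by
  obtain ⟨v, rfl⟩ := exists_edgeAt h3 hc hd e
  rw [← mem_faceVerts_iff_edgeAt_mem_boundary, cFace_edgeAt, Subtype.mk.injEq]
  have := mem_faceVerts_iff h3 hc (φ := flag h3 hc hd v) (f := f)
    ((col_flag h3 hc hd v).trans hf.symm)
  rwa [vert_flag] at this

lemma mem_faceEdges_iff_cFace {f : F} (hf : col f = Color.C) (e : {e : E // L.Avoids col d e}) :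
    e.1 ∈ L.faceEdges f ↔ cFace hc hd e = ⟨f, hf⟩ := by
  obtain ⟨e, he⟩ := e
  obtain ⟨φ, rfl, hφ⟩ := exists_col_eq_of_avoids hc hd he
  rw [cFace_eq hc hd hφ, Subtype.mk.injEq]
  exact mem_faceEdges_iff hc (by rw [hφ, hf])

end Flag

/-! ### The faces of color `C` as a system of cycles -/

/-- The boundaries of the faces of color `C`, with the `AC` edges as edges of the first type and the
`BC` edges as edges of the second type. -/
def cycles (h3 : L.ThreeValent) (hc : L.ProperColoring col) :
    CycleSystem V (ToricQubits L col) {f : F // col f = Color.C} where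
  α v := Sum.inr (edgeAt h3 hc (d := Color.B) (by decide) v)
  β v := Sum.inl (edgeAt h3 hc (d := Color.A) (by decide) v)
  snd q := q.isLeft
  comp := Sum.elim (cFace hc (by decide)) (cFace hc (by decide))
  root f := L.vert (L.face_surj f.1).choose
  not_snd_α _ := by simp
  snd_β _ := by simp
  exists_α := by
    rintro (e | e) h
    · simp at h
    · obtain ⟨v, rfl⟩ := exists_edgeAt h3 hc (by decide) e
      exact ⟨v, rfl⟩
  exists_β := by
    rintro (e | e) h
    · obtain ⟨v, rfl⟩ := exists_edgeAt h3 hc (by decide) e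
      exact ⟨v, rfl⟩
    · simp at h
  comp_β v := by
    simp only [Sum.elim_inl, Sum.elim_inr, cFace_edgeAt, Subtype.mk.injEq]
    exact face_flag_eq h3 hc _ _ v
  comp_root f := by
    have h := (L.face_surj f.1).choose_spec
    simp only [Sum.elim_inr, cFace_edgeAt]
    refine Subtype.ext ?_
    simp only
    rw [face_flag_vert h3 hc _ (by rw [h]; exact f.2), h]
  fiber_α v := ⟨opp h3 hc (d := Color.B) (by decide) v, opp_ne h3 hc _ v, fun u => by
    rw [Sum.inr.injEq]; exact edgeAt_eq_iff h3 hc _ u v⟩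
  fiber_β v := ⟨opp h3 hc (d := Color.A) (by decide) v, opp_ne h3 hc _ v, fun u => by
    rw [Sum.inl.injEq]; exact edgeAt_eq_iff h3 hc _ u v⟩
  induct := by
    intro P hr hα hβ v
    have hA : Color.A ≠ Color.C := by decide
    have hB : Color.B ≠ Color.C := by decide
    have hAB : Color.A ≠ Color.B := by decide
    set f := L.face (flag h3 hc hA v) with hf
    have hfC : col f = Color.C := col_flag h3 hc hA v
    have hs := (L.face_surj f).choose_spec
    have horb := (L.face_eq_iff _ _).1 (hs.trans hf)
    -- Walking around the face: `τ1` stays at the vertex, and `τ0` crosses an edge that is of one of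
    -- the two types according to whether it avoids `A`.
    have key : ∀ ψ, SameOrbit L.τ0 L.τ1 (L.face_surj f).choose ψ →
        col (L.face ψ) = Color.C ∧ P (L.vert ψ) := by
      intro ψ h
      unfold SameOrbit at h
      induction h with
      | refl => exact ⟨by rw [hs, hfC], hr ⟨f, hfC⟩⟩
      | @tail a b _ hstep ih =>
        obtain ⟨h1, h2⟩ := ih
        rcases hstep with rfl | rfl
        · have h1' : col (L.face (L.τ0 a)) = Color.C := by rw [L.face_τ0, h1]
          refine ⟨h1', ?_⟩
          by_cases hav : L.Avoids col Color.A (L.edge a)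
          · refine hβ (L.vert a) _ (congrArg Sum.inl (Subtype.ext ?_)) h2
            change L.edge (flag h3 hc hA _) = L.edge (flag h3 hc hA _)
            rw [flag_vert h3 hc hA h1 hav,
              flag_vert h3 hc hA h1' (by rw [L.edge_τ0]; exact hav), L.edge_τ0]
          · rw [← avoids_iff_not_avoids hc hB hA hAB.symm h1] at hav
            refine hα (L.vert a) _ (congrArg Sum.inr (Subtype.ext ?_)) h2
            change L.edge (flag h3 hc hB _) = L.edge (flag h3 hc hB _)
            rw [flag_vert h3 hc hB h1 hav,
              flag_vert h3 hc hB h1' (by rw [L.edge_τ0]; exact hav), L.edge_τ0]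
        · rw [L.face_τ1, L.vert_τ1]
          exact ⟨h1, h2⟩
    have := (key _ horb).2
    rwa [vert_flag] at this

end Lattice

/-! ### Indicator vectors of faces and their edge differences. -/

lemma ind_image_inl {Q R : Type*} (T : Set Q) :
    ind (Sum.inl '' T : Set (Q ⊕ R)) = Sum.elim (ind T) 0 := by
  classical
  funext q
  rcases q with q | q <;> simp [ind]

lemma ind_image_inr {Q R : Type*} (T : Set R) :
    ind (Sum.inr '' T : Set (Q ⊕ R)) = Sum.elim (0 : Q → Fin 2) (ind T) := by
  classical
  funext q
  rcases q with q | q <;> simp [ind]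

lemma ind_add_ind {Q R : Type*} {S : Set Q} {T : Set R} {v w : Q} {q : R}
    (h : q ∈ T ↔ ¬ (v ∈ S ↔ w ∈ S)) : ind S v + ind S w = ind T q := by
  classical
  by_cases hv : v ∈ S <;> by_cases hw : w ∈ S <;> simp [ind, h, hv, hw]

lemma ind_add_ind_eq_zero {Q : Type*} {S : Set Q} {v w : Q} (h : v ∈ S ↔ w ∈ S) :
    ind S v + ind S w = 0 := by
  classical
  by_cases hw : w ∈ S <;> simp [ind, h, hw]

namespace Lattice

variable {V E F Φ : Type*} {L : Lattice V E F Φ} {col : F → Color} (h3 : L.ThreeValent)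
  (hc : L.ProperColoring col)

lemma A_ne_C : Color.A ≠ Color.C := by decide

lemma B_ne_C : Color.B ≠ Color.C := by decide

lemma mem_faceVerts_iff_comp {f : F} (hf : col f = Color.C) (v : V) :
    v ∈ L.faceVerts f ↔ (cycles h3 hc).comp ((cycles h3 hc).α v) = ⟨f, hf⟩ := by
  rw [mem_faceVerts_iff_edgeAt_mem_boundary h3 hc B_ne_C (by rw [hf]; decide),
    mem_boundary_iff_cFace h3 hc B_ne_C hf]
  rfl

lemma mem_faceEdges_iff_comp {f : F} (hf : col f = Color.C) (q : ToricQubits L col) :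
    ToricQubits.edge q ∈ L.faceEdges f ↔ (cycles h3 hc).comp q = ⟨f, hf⟩ := by
  rcases q with e | e
  · exact mem_faceEdges_iff_cFace hc A_ne_C hf e
  · exact mem_faceEdges_iff_cFace hc B_ne_C hf e

lemma sndEdges_eq (f : {f : F // col f = Color.C}) : (cycles h3 hc).sndEdges f =
    Sum.inl '' (L.shrink col h3 hc Color.A).boundary ⟨f.1, by rw [f.2]; decide⟩ := by
  ext q
  rcases q with e | e
  · rw [Sum.inl_injective.mem_set_image, mem_boundary_iff_cFace h3 hc A_ne_C f.2]
    exact and_iff_right rfl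
  · simp [CycleSystem.sndEdges, cycles]

lemma fstEdges_eq (f : {f : F // col f = Color.C}) : (cycles h3 hc).fstEdges f =
    Sum.inr '' (L.shrink col h3 hc Color.B).boundary ⟨f.1, by rw [f.2]; decide⟩ := by
  ext q
  rcases q with e | e
  · simp [CycleSystem.fstEdges, cycles]
  · rw [Sum.inr_injective.mem_set_image, mem_boundary_iff_cFace h3 hc B_ne_C f.2]
    exact and_iff_right (by simp [cycles])

variable [Fintype V] [DecidableEq V] [Fintype E] [DecidableEq E] [Fintype F]
  [Fintype {e : E // L.Avoids col Color.A e}] [Fintype {e : E // L.Avoids col Color.B e}]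
  [Fintype {f : F // col f = Color.C}] [DecidableEq {f : F // col f = Color.C}]

/-- A face of color other than `B` survives the shrinking of `B`, so whether it contains a vertex
depends only on the `AC` edge there. Both ends of that edge give the same answer. -/
lemma δ_α_eq_zero {f : F} (hf : col f ≠ Color.B) (e : {e : E // L.Avoids col Color.B e}) :
    (cycles h3 hc).δ (ind (L.faceVerts f)) (Sum.inr e) = 0 := by
  obtain ⟨v, rfl⟩ := exists_edgeAt h3 hc B_ne_C e
  have h := (cycles h3 hc).δ_α (opp_ne h3 hc B_ne_C v)
    (fun u => by rw [← edgeAt_eq_iff]; exact Sum.inr_injective.eq_iff) (ind (L.faceVerts f))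
  refine h.trans (ind_add_ind_eq_zero ?_)
  rw [mem_faceVerts_iff_edgeAt_mem_boundary h3 hc B_ne_C hf,
    mem_faceVerts_iff_edgeAt_mem_boundary h3 hc B_ne_C hf,
    (edgeAt_eq_iff h3 hc B_ne_C (opp h3 hc B_ne_C v) v).2 (Or.inr rfl)]

lemma δ_β_eq_zero {f : F} (hf : col f ≠ Color.A) (e : {e : E // L.Avoids col Color.A e}) :
    (cycles h3 hc).δ (ind (L.faceVerts f)) (Sum.inl e) = 0 := by
  obtain ⟨v, rfl⟩ := exists_edgeAt h3 hc A_ne_C e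
  have h := (cycles h3 hc).δ_β (opp_ne h3 hc A_ne_C v)
    (fun u => by rw [← edgeAt_eq_iff]; exact Sum.inl_injective.eq_iff) (ind (L.faceVerts f))
  refine h.trans (ind_add_ind_eq_zero ?_)
  rw [mem_faceVerts_iff_edgeAt_mem_boundary h3 hc A_ne_C hf,
    mem_faceVerts_iff_edgeAt_mem_boundary h3 hc A_ne_C hf,
    (edgeAt_eq_iff h3 hc A_ne_C (opp h3 hc A_ne_C v) v).2 (Or.inr rfl)]

lemma δ_α_eq {f : F} (hf : col f = Color.B) (e : {e : E // L.Avoids col Color.B e}) :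
    (cycles h3 hc).δ (ind (L.faceVerts f)) (Sum.inr e) =
      ind ((L.shrink col h3 hc Color.B).coboundary ⟨f, hf⟩) e := by
  obtain ⟨v, rfl⟩ := exists_edgeAt h3 hc B_ne_C e
  have h := (cycles h3 hc).δ_α (opp_ne h3 hc B_ne_C v)
    (fun u => by rw [← edgeAt_eq_iff]; exact Sum.inr_injective.eq_iff) (ind (L.faceVerts f))
  exact h.trans (ind_add_ind (edgeAt_mem_coboundary_iff h3 hc B_ne_C hf v))

lemma δ_β_eq {f : F} (hf : col f = Color.A) (e : {e : E // L.Avoids col Color.A e}) :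
    (cycles h3 hc).δ (ind (L.faceVerts f)) (Sum.inl e) =
      ind ((L.shrink col h3 hc Color.A).coboundary ⟨f, hf⟩) e := by
  obtain ⟨v, rfl⟩ := exists_edgeAt h3 hc A_ne_C e
  have h := (cycles h3 hc).δ_β (opp_ne h3 hc A_ne_C v)
    (fun u => by rw [← edgeAt_eq_iff]; exact Sum.inl_injective.eq_iff) (ind (L.faceVerts f))
  exact h.trans (ind_add_ind (edgeAt_mem_coboundary_iff h3 hc A_ne_C hf v))

/-! ### Images of the generators of the color code -/

/-- Conjugation by the unitary of the system of cycles. -/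
def unfoldHom : (Op V V)ˣ →* (Op (ToricQubits L col) (ToricQubits L col))ˣ :=
  conjHom (cycles h3 hc).unitary (cycles h3 hc).unitary_mul_conjTranspose
    (cycles h3 hc).conjTranspose_mul_unitary

/-- The product of the `Z` generators of the faces of color `C` in the lattice with the faces of
color `A` shrunk, over those `C` faces whose marked vertex belongs to `f`. -/
def sndFactor (f : F) : ToricQubits L col → Fin 2 :=
  (cycles h3 hc).rootSum (fun k => ind ((cycles h3 hc).sndEdges k)) (ind (L.faceVerts f))

/-- The analogue of `sndFactor` for the lattice with the faces of color `B` shrunk. -/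
def fstFactor (f : F) : ToricQubits L col → Fin 2 :=
  (cycles h3 hc).rootSum (fun k => ind ((cycles h3 hc).fstEdges k)) (ind (L.faceVerts f))

/-- A `C` face contains its own marked vertex and no other, since each vertex lies on a single `C`
face. -/
lemma rootSum_of_col_C (r : {f : F // col f = Color.C} → ToricQubits L col → Fin 2)
    (f : {f : F // col f = Color.C}) :
    (cycles h3 hc).rootSum r (ind (L.faceVerts f.1)) = r f := by
  classical
  have h : ∀ k, ind (L.faceVerts f.1) ((cycles h3 hc).root k) = 1 ↔ k = f := by
    intro k
    have : (cycles h3 hc).root k ∈ L.faceVerts f.1 ↔ k = f := by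
      rw [mem_faceVerts_iff_comp h3 hc f.2, (cycles h3 hc).comp_root]
    rw [← this]
    by_cases hk : (cycles h3 hc).root k ∈ L.faceVerts f.1 <;> simp [ind, hk]
  rw [CycleSystem.rootSum, sum_eq_single f]
  · rw [if_pos ((h f).2 rfl)]
  · intro k _ hk
    rw [if_neg fun h' => hk ((h k).1 h')]
  · simp

lemma unfoldHom_XOn_of_col_A {f : F} (hf : col f = Color.A) :
    unfoldHom h3 hc (XOn (L.faceVerts f)) = ZUnit (sndFactor h3 hc f) *
      XUnit (Sum.elim (ind ((L.shrink col h3 hc Color.A).coboundary ⟨f, hf⟩)) 0) := by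
  rw [XOn_eq]
  refine conjHom_eq ((cycles h3 hc).unitary_mul_Xop_of_δ (funext ?_) (Or.inl ?_))
  · rintro (e | e)
    · exact δ_β_eq h3 hc hf e
    · exact δ_α_eq_zero h3 hc (by rw [hf]; decide) e
  · rintro (e | e) h
    · exact absurd rfl h
    · rfl

lemma unfoldHom_XOn_of_col_B {f : F} (hf : col f = Color.B) :
    unfoldHom h3 hc (XOn (L.faceVerts f)) = ZUnit (sndFactor h3 hc f) *
      XUnit (Sum.elim 0 (ind ((L.shrink col h3 hc Color.B).coboundary ⟨f, hf⟩))) := by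
  rw [XOn_eq]
  refine conjHom_eq ((cycles h3 hc).unitary_mul_Xop_of_δ (funext ?_) (Or.inr ?_))
  · rintro (e | e)
    · exact δ_β_eq_zero h3 hc (by rw [hf]; decide) e
    · exact δ_α_eq h3 hc hf e
  · rintro (e | e) h
    · rfl
    · exact absurd h (by simp [cycles])

lemma unfoldHom_XOn_of_col_C (f : {f : F // col f = Color.C}) :
    unfoldHom h3 hc (XOn (L.faceVerts f.1)) = ZUnit (ind ((cycles h3 hc).sndEdges f)) := by
  have hδ : (cycles h3 hc).δ (ind (L.faceVerts f.1)) = 0 := by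
    funext q
    rcases q with e | e
    · exact δ_β_eq_zero h3 hc (by rw [f.2]; decide) e
    · exact δ_α_eq_zero h3 hc (by rw [f.2]; decide) e
  have h := (cycles h3 hc).unitary_mul_Xop_of_δ hδ (Or.inl fun _ _ => rfl)
  rw [rootSum_of_col_C h3 hc, Xop_zero, Op.mul_one] at h
  rw [XOn_eq]
  exact conjHom_eq h

/-- The vertices of `f` are the ends of the `AC` edges on its boundary, so `Z(f)` is a product of
pairs `Z Z` over edges of the first type. A `C` face is also covered by the analogous lemma for `A`,
using its `BC` edges. -/
lemma unfoldHom_ZOn_of_col_ne_B {f : F} (hf : col f ≠ Color.B) :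
    unfoldHom h3 hc (ZOn (L.faceVerts f)) =
      ZUnit (Sum.elim 0 (ind ((L.shrink col h3 hc Color.B).boundary ⟨f, hf⟩))) *
        ZUnit (sndFactor h3 hc f) := by
  have h := (cycles h3 hc).unitary_mul_Zop_of_not_snd
    (R := Sum.inr '' (L.shrink col h3 hc Color.B).boundary ⟨f, hf⟩)
    (by rintro _ ⟨e, _, rfl⟩; simp [cycles])
  have hs : (cycles h3 hc).α ⁻¹' (Sum.inr '' (L.shrink col h3 hc Color.B).boundary ⟨f, hf⟩)
      = L.faceVerts f := by
    ext v
    rw [mem_faceVerts_iff_edgeAt_mem_boundary h3 hc B_ne_C hf]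
    exact Sum.inr_injective.mem_set_image
  rw [hs, ind_image_inr] at h
  rw [ZOn_eq, ← ZUnit_add]
  exact conjHom_eq h

lemma unfoldHom_ZOn_of_col_ne_A {f : F} (hf : col f ≠ Color.A) :
    unfoldHom h3 hc (ZOn (L.faceVerts f)) =
      ZUnit (Sum.elim (ind ((L.shrink col h3 hc Color.A).boundary ⟨f, hf⟩)) 0) *
        ZUnit (fstFactor h3 hc f) := by
  have h := (cycles h3 hc).unitary_mul_Zop_of_snd
    (R := Sum.inl '' (L.shrink col h3 hc Color.A).boundary ⟨f, hf⟩)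
    (by rintro _ ⟨e, _, rfl⟩; simp [cycles])
  have hs : (cycles h3 hc).β ⁻¹' (Sum.inl '' (L.shrink col h3 hc Color.A).boundary ⟨f, hf⟩)
      = L.faceVerts f := by
    ext v
    rw [mem_faceVerts_iff_edgeAt_mem_boundary h3 hc A_ne_C hf]
    exact Sum.inl_injective.mem_set_image
  rw [hs, ind_image_inl] at h
  rw [ZOn_eq, ← ZUnit_add]
  exact conjHom_eq h

/-- The group is arbitrary because the correction factors have to be absorbed in both inclusions. -/
lemma sndFactor_mem (H : Subgroup (Op (ToricQubits L col) (ToricQubits L col))ˣ)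
    (h : ∀ k, ZUnit (ind ((cycles h3 hc).sndEdges k)) ∈ H) (f : F) :
    ZUnit (sndFactor h3 hc f) ∈ H := by
  refine ZUnit_sum_mem H _ _ fun k _ => ?_
  split_ifs
  · exact h k
  · rw [ZUnit_zero]; exact H.one_mem

lemma fstFactor_mem (H : Subgroup (Op (ToricQubits L col) (ToricQubits L col))ˣ)
    (h : ∀ k, ZUnit (ind ((cycles h3 hc).fstEdges k)) ∈ H) (f : F) :
    ZUnit (fstFactor h3 hc f) ∈ H := by
  refine ZUnit_sum_mem H _ _ fun k _ => ?_
  split_ifs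
  · exact h k
  · rw [ZUnit_zero]; exact H.one_mem

/-! ### Comparison of the two stabilizer groups. -/

/-- The group of operators `S ⊗ T` with `S`, `T` in the stabilizer groups of the two toric codes. -/
def toricGroup : Subgroup (Op (ToricQubits L col) (ToricQubits L col))ˣ :=
  ((toricCode (L.shrink col h3 hc Color.A)).prod
    (toricCode (L.shrink col h3 hc Color.B))).map tensorHom

lemma tensorHom_mk_one_mem {g} (hg : g ∈ toricCode (L.shrink col h3 hc Color.A)) :
    tensorHom (g, 1) ∈ toricGroup h3 hc := ⟨(g, 1), ⟨hg, Subgroup.one_mem _⟩, rfl⟩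

lemma tensorHom_one_mk_mem {g} (hg : g ∈ toricCode (L.shrink col h3 hc Color.B)) :
    tensorHom (1, g) ∈ toricGroup h3 hc := ⟨(1, g), ⟨Subgroup.one_mem _, hg⟩, rfl⟩

lemma XUnit_inl_mem (f) : XUnit (Sum.elim (ind ((L.shrink col h3 hc Color.A).coboundary f)) 0) ∈
    toricGroup h3 hc := by
  rw [← tensorHom_XUnit, XUnit_zero, ← XOn_eq]
  exact tensorHom_mk_one_mem h3 hc (Subgroup.subset_closure (Or.inl ⟨f, rfl⟩))

lemma XUnit_inr_mem (f) : XUnit (Sum.elim 0 (ind ((L.shrink col h3 hc Color.B).coboundary f))) ∈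
    toricGroup h3 hc := by
  rw [← tensorHom_XUnit, XUnit_zero, ← XOn_eq]
  exact tensorHom_one_mk_mem h3 hc (Subgroup.subset_closure (Or.inl ⟨f, rfl⟩))

lemma ZUnit_inl_mem (f) : ZUnit (Sum.elim (ind ((L.shrink col h3 hc Color.A).boundary f)) 0) ∈
    toricGroup h3 hc := by
  rw [← tensorHom_ZUnit, ZUnit_zero, ← ZOn_eq]
  exact tensorHom_mk_one_mem h3 hc (Subgroup.subset_closure (Or.inr ⟨f, rfl⟩))

lemma ZUnit_inr_mem (f) : ZUnit (Sum.elim 0 (ind ((L.shrink col h3 hc Color.B).boundary f))) ∈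
    toricGroup h3 hc := by
  rw [← tensorHom_ZUnit, ZUnit_zero, ← ZOn_eq]
  exact tensorHom_one_mk_mem h3 hc (Subgroup.subset_closure (Or.inr ⟨f, rfl⟩))

lemma map_colorCode_le : (colorCode L).map (unfoldHom h3 hc) ≤ toricGroup h3 hc := by
  have hsnd : ∀ k, ZUnit (ind ((cycles h3 hc).sndEdges k)) ∈ toricGroup h3 hc := fun k => by
    rw [sndEdges_eq, ind_image_inl]; exact ZUnit_inl_mem h3 hc _
  have hfst : ∀ k, ZUnit (ind ((cycles h3 hc).fstEdges k)) ∈ toricGroup h3 hc := fun k => by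
    rw [fstEdges_eq, ind_image_inr]; exact ZUnit_inr_mem h3 hc _
  rw [Subgroup.map_le_iff_le_comap, colorCode, Subgroup.closure_le]
  rintro _ (⟨f, rfl⟩ | ⟨f, rfl⟩)
  · rw [SetLike.mem_coe, Subgroup.mem_comap]
    rcases hf : col f with _ | _ | _
    · rw [unfoldHom_XOn_of_col_A h3 hc hf]
      exact mul_mem (sndFactor_mem h3 hc _ hsnd f) (XUnit_inl_mem h3 hc _)
    · rw [unfoldHom_XOn_of_col_B h3 hc hf]
      exact mul_mem (sndFactor_mem h3 hc _ hsnd f) (XUnit_inr_mem h3 hc _)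
    · rw [unfoldHom_XOn_of_col_C h3 hc ⟨f, hf⟩]
      exact hsnd _
  · rw [SetLike.mem_coe, Subgroup.mem_comap]
    by_cases hf : col f = Color.A
    · rw [unfoldHom_ZOn_of_col_ne_B h3 hc (by rw [hf]; decide)]
      exact mul_mem (ZUnit_inr_mem h3 hc _) (sndFactor_mem h3 hc _ hsnd f)
    · rw [unfoldHom_ZOn_of_col_ne_A h3 hc hf]
      exact mul_mem (ZUnit_inl_mem h3 hc _) (fstFactor_mem h3 hc _ hfst f)

/-- The order of extraction matters. `X` on `C` faces gives `hsnd`, which removes the corrections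
from `Z` on faces not colored `B` and gives `hinr`. The `C` faces among these give `hfst`, which
removes the corrections from `Z` on faces not colored `A`. The `X` generators need only `hsnd`. -/
lemma le_map_colorCode : toricGroup h3 hc ≤ (colorCode L).map (unfoldHom h3 hc) := by
  set H := (colorCode L).map (unfoldHom h3 hc) with hH
  have hX : ∀ f, unfoldHom h3 hc (XOn (L.faceVerts f)) ∈ H := fun f =>
    ⟨_, Subgroup.subset_closure (Or.inl ⟨f, rfl⟩), rfl⟩
  have hZ : ∀ f, unfoldHom h3 hc (ZOn (L.faceVerts f)) ∈ H := fun f =>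
    ⟨_, Subgroup.subset_closure (Or.inr ⟨f, rfl⟩), rfl⟩
  have hsnd : ∀ k, ZUnit (ind ((cycles h3 hc).sndEdges k)) ∈ H := fun k => by
    rw [← unfoldHom_XOn_of_col_C]; exact hX k.1
  have hinr : ∀ f, ZUnit (Sum.elim 0 (ind ((L.shrink col h3 hc Color.B).boundary f))) ∈ H := by
    rintro ⟨f, hf⟩
    have h := hZ f
    rw [unfoldHom_ZOn_of_col_ne_B h3 hc hf] at h
    exact (Subgroup.mul_mem_cancel_right H (sndFactor_mem h3 hc H hsnd f)).1 h
  have hfst : ∀ k, ZUnit (ind ((cycles h3 hc).fstEdges k)) ∈ H := fun k => by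
    rw [fstEdges_eq, ind_image_inr]; exact hinr _
  have hinl : ∀ f, ZUnit (Sum.elim (ind ((L.shrink col h3 hc Color.A).boundary f)) 0) ∈ H := by
    rintro ⟨f, hf⟩
    have h := hZ f
    rw [unfoldHom_ZOn_of_col_ne_A h3 hc hf] at h
    exact (Subgroup.mul_mem_cancel_right H (fstFactor_mem h3 hc H hfst f)).1 h
  have hA : toricCode (L.shrink col h3 hc Color.A) ≤
      H.comap (tensorHom.comp (MonoidHom.inl _ _)) := by
    rw [toricCode, Subgroup.closure_le]
    rintro _ (⟨⟨f, hf⟩, rfl⟩ | ⟨f, rfl⟩)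
    · change tensorHom (XOn _, 1) ∈ H
      rw [XOn_eq, ← XUnit_zero, tensorHom_XUnit]
      have h := hX f
      rw [unfoldHom_XOn_of_col_A h3 hc hf] at h
      exact (Subgroup.mul_mem_cancel_left H (sndFactor_mem h3 hc H hsnd f)).1 h
    · change tensorHom (ZOn _, 1) ∈ H
      rw [ZOn_eq, ← ZUnit_zero, tensorHom_ZUnit]
      exact hinl f
  have hB : toricCode (L.shrink col h3 hc Color.B) ≤
      H.comap (tensorHom.comp (MonoidHom.inr _ _)) := by
    rw [toricCode, Subgroup.closure_le]
    rintro _ (⟨⟨f, hf⟩, rfl⟩ | ⟨f, rfl⟩)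
    · change tensorHom (1, XOn _) ∈ H
      rw [XOn_eq, ← XUnit_zero, tensorHom_XUnit]
      have h := hX f
      rw [unfoldHom_XOn_of_col_B h3 hc hf] at h
      exact (Subgroup.mul_mem_cancel_left H (sndFactor_mem h3 hc H hsnd f)).1 h
    · change tensorHom (1, ZOn _) ∈ H
      rw [ZOn_eq, ← ZUnit_zero, tensorHom_ZUnit]
      exact hinr f
  rintro _ ⟨⟨g, h⟩, ⟨hg, hh⟩, rfl⟩
  have : (g, h) = (g, 1) * (1, h) := by simp
  rw [this, map_mul]
  exact mul_mem (hA hg) (hB hh)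

end Lattice

end ColorCode

end

open ColorCode in
open scoped Classical in
theorem theorem1 {V E F Φ : Type*} [Fintype V] [Fintype E] [Fintype F] [Fintype Φ]
    (L : Lattice V E F Φ) (h3 : L.ThreeValent)
    (col : F → Color) (hc : L.ProperColoring col) :
    ∃ U_ : ∀ f : {f : F // col f = Color.C}, Op (EdgesOn L col f.1) (VertsOn L f.1),
      (∀ f, IsClifford (U_ f)) ∧
      ∃ U : Op (ToricQubits L col) V,
        U = tensorOverC L col U_ ∧
        IsClifford U ∧
        {T | ∃ M ∈ ops (colorCode L), T = U * M * U.conjTranspose} =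
          tensorGroup (toricCode (L.shrink col h3 hc Color.A))
            (toricCode (L.shrink col h3 hc Color.B)) := by
  refine ⟨fun f => ((Lattice.cycles h3 hc).restrict f (Lattice.mem_faceVerts_iff_comp h3 hc f.2)
      (Lattice.mem_faceEdges_iff_comp h3 hc f.2)).unitary,
    fun f => CycleSystem.isClifford_unitary _, (Lattice.cycles h3 hc).unitary, ?_,
    CycleSystem.isClifford_unitary _, ?_⟩
  · ext x y
    exact (Lattice.cycles h3 hc).unitary_eq_prod
      (fun f => Lattice.mem_faceVerts_iff_comp h3 hc f.2)
      (fun f => Lattice.mem_faceEdges_iff_comp h3 hc f.2) x y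
  · rw [tensorGroup_eq]
    exact (conj_ops_eq _ (Lattice.cycles h3 hc).unitary_mul_conjTranspose
      (Lattice.cycles h3 hc).conjTranspose_mul_unitary _).trans
      (congrArg ops (le_antisymm (Lattice.map_colorCode_le h3 hc) (Lattice.le_map_colorCode h3 hc)))
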